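/- A pseudoline is the image of a straight line under a homeomorphism of the Euclidean plane. Let $L$ be a simple arrangement of $n\ge 3$ pseudolines in the Euclidean plane: any two of the pseudolines meet in exactly one point, at which they cross, and no three of them have a common point. Let $G$ be the graph of the arrangement: its vertices are the intersection points of the pseudolines, and two distinct vertices are adjacent if they lie on a common pseudoline with no other vertex on the part of that pseudoline between them. Let $R(G)$ be the realization of $G$ in the plane, that is, the union of the pseudolines after the two unbounded end segments (beyond the first and the last vertex) of each pseudoline have been deleted. Then the diameter of $G$ is $n-2$, and a vertex $v$ of $G$ is diametrical (its eccentricity, the maximum distance from $v$ to a vertex of $G$, equals the diameter) if and only if $v$ lies on the boundary of the outer face of $R(G)$, that is, of the unbounded connected component of the complement of $R(G)$ in the plane. -/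

import Mathlib

/-- The Euclidean plane. -/
abbrev Plane : Type := EuclideanSpace ℝ (Fin 2)

/-- A pseudoline: the image of a line (without loss of generality the horizontal coordinate axis)
under a homeomorphism of the Euclidean plane. The homeomorphism is recorded as a parametrization;
the pseudoline itself is the subset `Pseudoline.carrier`. -/
structure Pseudoline where
  /-- The homeomorphism of the plane that straightens the pseudoline. -/
  homeo : Plane ≃ₜ Plane

namespace Pseudoline

/-- The parametrization of a pseudoline by the real line. -/
def curve (l : Pseudoline) (t : ℝ) : Plane := l.homeo !₂[t, 0]

/-- The pseudoline as a set of points. -/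
def carrier (l : Pseudoline) : Set Plane := Set.range l.curve

/-- One of the two open sides of the pseudoline. -/
def upperSide (l : Pseudoline) : Set Plane := l.homeo '' {p | 0 < p 1}

/-- The other open side of the pseudoline. -/
def lowerSide (l : Pseudoline) : Set Plane := l.homeo '' {p | p 1 < 0}

end Pseudoline

/-- A simple arrangement of `n` pseudolines in the Euclidean plane: any two of them meet in exactly
one point, where they cross, and no three of them have a common point. -/
structure SimpleArrangement (n : ℕ) where
  /-- The pseudolines of the arrangement. -/
  line : Fin n → Pseudoline
  meet_once : ∀ i j, i ≠ j → ∃! p : Plane, p ∈ (line i).carrier ∧ p ∈ (line j).carrier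
  /-- The two rays of `line j` issuing from its only common point with `line i` avoid `line i`, so
  that the two curves cross there if and only if `line j` has points on both sides of `line i`. -/
  cross : ∀ i j, i ≠ j → ((line j).carrier ∩ (line i).upperSide).Nonempty ∧
    ((line j).carrier ∩ (line i).lowerSide).Nonempty
  simple : ∀ i j k, i ≠ j → j ≠ k → i ≠ k →
    (line i).carrier ∩ (line j).carrier ∩ (line k).carrier = ∅

namespace SimpleArrangement

variable {n : ℕ} (A : SimpleArrangement n)

/-- The intersection points of the pseudolines. -/
def vertexSet : Set Plane :=
  {p | ∃ i j, i ≠ j ∧ p ∈ (A.line i).carrier ∧ p ∈ (A.line j).carrier}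

/-- The pseudoline arrangement graph: its vertices are the intersection points of the pseudolines,
and two of them are adjacent if they lie on a common pseudoline with no other vertex on the part of
that pseudoline between them. -/
def graph : SimpleGraph A.vertexSet where
  Adj p q := p ≠ q ∧ ∃ (i : Fin n) (s t : ℝ), (A.line i).curve s = p ∧ (A.line i).curve t = q ∧
    ∀ u ∈ Set.Ioo (min s t) (max s t), (A.line i).curve u ∉ A.vertexSet
  symm := ⟨by
    rintro p q ⟨hpq, i, s, t, hs, ht, h⟩
    refine ⟨hpq.symm, i, t, s, ht, hs, ?_⟩
    rwa [min_comm, max_comm]⟩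
  loopless := ⟨fun _ h => h.1 rfl⟩

/-- The pseudoline arrangement realization of the graph, as a set of points: from each pseudoline
only the part between its first and its last vertex is kept, that is, the two infinite end
segments are deleted. -/
def realization : Set Plane :=
  {p | ∃ (i : Fin n) (s u t : ℝ), s ≤ u ∧ u ≤ t ∧ (A.line i).curve s ∈ A.vertexSet ∧
    (A.line i).curve t ∈ A.vertexSet ∧ p = (A.line i).curve u}

/-- A face of the realization: a connected component of its complement in the plane. -/
def IsFace (F : Set Plane) : Prop :=
  ∃ x ∈ A.realizationᶜ, F = connectedComponentIn A.realizationᶜ x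

/-- The outer face of the realization is its unbounded face. -/
def IsOuterFace (F : Set Plane) : Prop :=
  A.IsFace F ∧ ¬ Bornology.IsBounded F

/-- The vertex `v` lies in (that is, on the boundary of) the outer face of the realization. -/
def LiesInOuterFace (v : A.vertexSet) : Prop :=
  ∃ F, A.IsOuterFace F ∧ (v : Plane) ∈ frontier F

/-- A vertex is diametrical if its eccentricity equals the diameter of the graph. -/
def IsDiametrical (v : A.vertexSet) : Prop :=
  A.graph.eccent v = A.graph.ediam

end SimpleArrangement

/-! Give each point its sign vector: for every pseudoline, the side it lies on, or 0. Along an edge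
exactly one sign leaves 0 and one reaches 0, so adjacent vertices have `sepDist` 2 and a walk from p
to q has length at least `sepDist p q / 2`. Vertices whose signs are opposite wherever both are
nonzero are therefore at distance at least n - 2 (`le_sepDist_of_opposite`); the two end vertices of
a pseudoline form such a pair.

Conversely, a walk that meets only pseudolines from H can be replaced by one of length at most #H -
2 (`exists_walk_length_add_two_le`). Of the two pseudolines through its start, the walk departs for
the last time from one, a, and never meets the other, b, again; going straight along a instead gets
rid of b after a single step. So each step uses up a pseudoline, and the diameter is n - 2.

A vertex v is diametrical iff no pseudoline strictly separates it from some point x of an unbounded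
end segment (a tail). Given x, the vertex at the far end of that pseudoline is opposite to v. Given
q at distance n - 2 from v, take a walk to q that stays on side β of a pseudoline b through v. Among
the pseudolines crossing b in one direction from v, some tail on side -β is separated from v by none
of them (`exists_nearest_tail`). A pseudoline crossing b in the other direction could separate it
from v only by meeting it on side -β, but then one of the two can be avoided on the way to q
(`exists_short_walk_of_wrapping`), giving distance at most n - 3.

Finally, cells of the arrangement are connected (`isPreconnected_cell`). If v and a tail point are
not separated, both are in the closure of one cell, which lies in the outer face. If there is no
such tail point, any face with v on its boundary lies in a cell without tails on its boundary, and
such a cell is bounded (`isBounded_cell`). -/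

namespace Pseudoline

/-! ### Straightening coordinates and sides of a pseudoline -/

/-- The signed height of a point over a pseudoline, in the straightening coordinates. -/
noncomputable def height (l : Pseudoline) (p : Plane) : ℝ := l.homeo.symm p 1

lemma continuous_height (l : Pseudoline) : Continuous l.height :=
  (EuclideanSpace.proj (𝕜 := ℝ) (1 : Fin 2)).continuous.comp l.homeo.symm.continuous

lemma continuous_curve (l : Pseudoline) : Continuous l.curve := by
  refine l.homeo.continuous.comp ?_
  exact (PiLp.continuous_toLp 2 _).comp (by fun_prop)

lemma height_homeo (l : Pseudoline) (p : Plane) : l.height (l.homeo p) = p 1 := by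
  simp [height]

lemma height_curve (l : Pseudoline) (t : ℝ) : l.height (l.curve t) = 0 := by
  simp [curve, height_homeo]

lemma curve_injective (l : Pseudoline) : Function.Injective l.curve := by
  intro s t h
  have := congrArg (fun p : Plane => p 0) (l.homeo.injective h)
  simpa using this

lemma mem_carrier_iff (l : Pseudoline) (p : Plane) : p ∈ l.carrier ↔ l.height p = 0 := by
  constructor
  · rintro ⟨t, rfl⟩
    exact l.height_curve t
  · intro h
    refine ⟨l.homeo.symm p 0, ?_⟩
    refine l.homeo.symm.injective ?_
    rw [curve, l.homeo.symm_apply_apply]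
    ext i
    fin_cases i
    · simp
    · simpa [height] using h.symm

lemma mem_upperSide_iff (l : Pseudoline) (p : Plane) : p ∈ l.upperSide ↔ 0 < l.height p := by
  constructor
  · rintro ⟨q, hq, rfl⟩
    rwa [height_homeo]
  · intro h
    exact ⟨l.homeo.symm p, h, by simp⟩

lemma mem_lowerSide_iff (l : Pseudoline) (p : Plane) : p ∈ l.lowerSide ↔ l.height p < 0 := by
  constructor
  · rintro ⟨q, hq, rfl⟩
    rwa [height_homeo]
  · intro h
    exact ⟨l.homeo.symm p, h, by simp⟩

end Pseudoline

/-- A continuous real function with exactly one zero that takes both signs has a constant sign on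
each side of the zero. -/
lemma exists_sign_eq_of_unique_zero {h : ℝ → ℝ} (hc : Continuous h) {c : ℝ}
    (hz : ∀ t, h t = 0 ↔ t = c) (hpos : ∃ t, 0 < h t) (hneg : ∃ t, h t < 0) :
    ∃ ε : ℤ, (ε = 1 ∨ ε = -1) ∧
      ∀ t, (SignType.sign (h t) : ℤ) = ε * (SignType.sign (t - c) : ℤ) := by
  have key : ∀ {s t : ℝ}, h s < 0 → 0 < h t → (s < c ∧ c < t) ∨ (t < c ∧ c < s) := by
    intro s t hs ht
    have hmem : (0 : ℝ) ∈ h '' Set.uIcc s t :=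
      intermediate_value_uIcc hc.continuousOn
        (Set.mem_uIcc.2 (Or.inl ⟨hs.le, ht.le⟩))
    obtain ⟨u, hu, hu0⟩ := hmem
    rw [hz] at hu0
    subst hu0
    have h1 : s ≠ u := fun e => by rw [(hz s).2 e] at hs; exact lt_irrefl _ hs
    have h2 : t ≠ u := fun e => by rw [(hz t).2 e] at ht; exact lt_irrefl _ ht
    rcases Set.mem_uIcc.1 hu with ⟨a, b⟩ | ⟨a, b⟩
    · exact Or.inl ⟨lt_of_le_of_ne a h1, lt_of_le_of_ne b h2.symm⟩
    · exact Or.inr ⟨lt_of_le_of_ne a h2, lt_of_le_of_ne b h1.symm⟩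
  obtain ⟨a, ha⟩ := hpos
  obtain ⟨b, hb⟩ := hneg
  rcases key hb ha with ⟨h1, h2⟩ | ⟨h1, h2⟩
  · refine ⟨1, Or.inl rfl, fun t => ?_⟩
    rcases lt_trichotomy (h t) 0 with ht | ht | ht
    · have : t < c := by rcases key ht ha with h | h <;> linarith
      simp [sign_neg ht, sign_neg (sub_neg.2 this)]
    · have := (hz t).1 ht
      rw [ht, this]; simp
    · have : c < t := by rcases key hb ht with h | h <;> linarith
      simp [sign_pos ht, sign_pos (sub_pos.2 this)]
  · refine ⟨-1, Or.inr rfl, fun t => ?_⟩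
    rcases lt_trichotomy (h t) 0 with ht | ht | ht
    · have : c < t := by rcases key ht ha with h | h <;> linarith
      simp [sign_neg ht, sign_pos (sub_pos.2 this)]
    · have := (hz t).1 ht
      rw [ht, this]; simp
    · have : t < c := by rcases key hb ht with h | h <;> linarith
      simp [sign_pos ht, sign_neg (sub_neg.2 this)]

/-! ### Sign vectors and crossing parameters -/

namespace SimpleArrangement

variable {n : ℕ} (A : SimpleArrangement n)

/-- The side of the `j`-th pseudoline on which a point lies, as a sign. -/
noncomputable def side (j : Fin n) (p : Plane) : ℤ := (SignType.sign ((A.line j).height p) : ℤ)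

lemma side_eq_zero_iff {j : Fin n} {p : Plane} : A.side j p = 0 ↔ p ∈ (A.line j).carrier := by
  rw [Pseudoline.mem_carrier_iff, side]
  rcases lt_trichotomy ((A.line j).height p) 0 with h | h | h
  · simp [sign_neg h, h.ne]
  · simp [h]
  · simp [sign_pos h, h.ne']

lemma side_cases (j : Fin n) (p : Plane) :
    A.side j p = 0 ∨ A.side j p = 1 ∨ A.side j p = -1 := by
  rw [side]
  rcases SignType.sign ((A.line j).height p) <;> simp

lemma side_curve_self (i : Fin n) (t : ℝ) : A.side i ((A.line i).curve t) = 0 :=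
  A.side_eq_zero_iff.2 ⟨t, rfl⟩

attribute [irreducible] side

lemma exists_crossing {i j : Fin n} (hij : i ≠ j) : ∃ (c : ℝ) (ε : ℤ), (ε = 1 ∨ ε = -1) ∧
    ∀ t, A.side j ((A.line i).curve t) = ε * (SignType.sign (t - c) : ℤ) := by
  obtain ⟨p, ⟨⟨c, hc⟩, hpj⟩, huniq⟩ := A.meet_once i j hij
  refine ⟨c, ?_⟩
  simp only [side]
  refine exists_sign_eq_of_unique_zero
    ((A.line j).continuous_height.comp (A.line i).continuous_curve) (c := c) ?_ ?_ ?_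
  · intro t
    rw [Function.comp_apply, ← Pseudoline.mem_carrier_iff]
    constructor
    · intro h
      exact (A.line i).curve_injective ((huniq _ ⟨⟨t, rfl⟩, h⟩).trans hc.symm)
    · rintro rfl
      rwa [hc]
  · obtain ⟨_, ⟨t, rfl⟩, h⟩ := (A.cross j i hij.symm).1
    exact ⟨t, ((A.line j).mem_upperSide_iff _).1 h⟩
  · obtain ⟨_, ⟨t, rfl⟩, h⟩ := (A.cross j i hij.symm).2
    exact ⟨t, ((A.line j).mem_lowerSide_iff _).1 h⟩

open Classical in
/-- The parameter on the `i`-th pseudoline of its crossing with the `j`-th one. -/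
noncomputable def crossParam (i j : Fin n) : ℝ :=
  if h : i ≠ j then (A.exists_crossing h).choose else 0

open Classical in
/-- The side of the `j`-th pseudoline to which the `i`-th one leads. -/
noncomputable def orient (i j : Fin n) : ℤ :=
  if h : i ≠ j then (A.exists_crossing h).choose_spec.choose else 0

lemma orient_cases {i j : Fin n} (h : i ≠ j) : A.orient i j = 1 ∨ A.orient i j = -1 := by
  rw [orient, dif_pos h]
  exact (A.exists_crossing h).choose_spec.choose_spec.1

lemma side_curve {i j : Fin n} (h : i ≠ j) (t : ℝ) : A.side j ((A.line i).curve t) =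
    A.orient i j * (SignType.sign (t - A.crossParam i j) : ℤ) := by
  rw [orient, dif_pos h, crossParam, dif_pos h]
  exact (A.exists_crossing h).choose_spec.choose_spec.2 t

lemma side_curve_of_lt {i j : Fin n} (h : i ≠ j) {t : ℝ} (ht : t < A.crossParam i j) :
    A.side j ((A.line i).curve t) = - A.orient i j := by
  rw [A.side_curve h, sign_neg (sub_neg.2 ht)]; simp

lemma side_curve_of_gt {i j : Fin n} (h : i ≠ j) {t : ℝ} (ht : A.crossParam i j < t) :
    A.side j ((A.line i).curve t) = A.orient i j := by
  rw [A.side_curve h, sign_pos (sub_pos.2 ht)]; simp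

lemma side_curve_crossParam {i j : Fin n} (h : i ≠ j) :
    A.side j ((A.line i).curve (A.crossParam i j)) = 0 := by
  rw [A.side_curve h]; simp

lemma side_curve_eq_zero_iff {i j : Fin n} (h : i ≠ j) {t : ℝ} :
    A.side j ((A.line i).curve t) = 0 ↔ t = A.crossParam i j := by
  have ho := A.orient_cases h
  rcases lt_trichotomy t (A.crossParam i j) with ht | ht | ht
  · rw [A.side_curve_of_lt h ht]
    constructor
    · intro; omega
    · intro h; exact absurd h ht.ne
  · rw [ht, A.side_curve_crossParam h]; simp
  · rw [A.side_curve_of_gt h ht]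
    constructor
    · intro; omega
    · intro h; exact absurd h ht.ne'

lemma curve_crossParam_eq {i j : Fin n} (h : i ≠ j) :
    (A.line i).curve (A.crossParam i j) = (A.line j).curve (A.crossParam j i) := by
  obtain ⟨p, -, huniq⟩ := A.meet_once i j h
  rw [huniq _ ⟨⟨_, rfl⟩, A.side_eq_zero_iff.1 (A.side_curve_crossParam h)⟩,
    huniq _ ⟨A.side_eq_zero_iff.1 (A.side_curve_crossParam h.symm), ⟨_, rfl⟩⟩]

/-- No point lies on three pseudolines. -/
lemma eq_or_eq_of_side_eq_zero {i j k : Fin n} {p : Plane} (hij : i ≠ j) (hi : A.side i p = 0)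
    (hj : A.side j p = 0) (hk : A.side k p = 0) : k = i ∨ k = j := by
  by_contra! hne
  have := A.simple i j k hij hne.2.symm hne.1.symm
  rw [Set.eq_empty_iff_forall_notMem] at this
  exact this p ⟨⟨A.side_eq_zero_iff.1 hi, A.side_eq_zero_iff.1 hj⟩, A.side_eq_zero_iff.1 hk⟩

/-- Two pseudolines have only one common point. -/
lemma eq_of_side_eq_zero {i j : Fin n} (hij : i ≠ j) {p q : Plane} (hpi : A.side i p = 0)
    (hpj : A.side j p = 0) (hqi : A.side i q = 0) (hqj : A.side j q = 0) : p = q := by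
  simp only [side_eq_zero_iff] at *
  exact (A.meet_once i j hij).unique ⟨hpi, hpj⟩ ⟨hqi, hqj⟩

lemma crossParam_injective {i j k : Fin n} (hij : i ≠ j) (hik : i ≠ k)
    (h : A.crossParam i j = A.crossParam i k) : j = k := by
  by_contra hjk
  have h1 := A.side_curve_crossParam hij
  have h2 := A.side_curve_crossParam hik
  rw [← h] at h2
  rcases A.eq_or_eq_of_side_eq_zero hij (A.side_curve_self i _) h1 h2 with e | e
  · exact hik e.symm
  · exact hjk e.symm

/-- The vertex in which two pseudolines meet. -/
noncomputable def meet {i j : Fin n} (h : i ≠ j) : A.vertexSet :=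
  ⟨(A.line i).curve (A.crossParam i j), i, j, h, ⟨_, rfl⟩,
    A.side_eq_zero_iff.1 (A.side_curve_crossParam h)⟩

lemma coe_meet {i j : Fin n} (h : i ≠ j) :
    (A.meet h : Plane) = (A.line i).curve (A.crossParam i j) := rfl

attribute [irreducible] meet

lemma side_meet_left {i j : Fin n} (h : i ≠ j) : A.side i (A.meet h) = 0 := by
  rw [coe_meet, side_curve_self]

lemma side_meet_right {i j : Fin n} (h : i ≠ j) : A.side j (A.meet h) = 0 := by
  rw [coe_meet, A.side_curve_crossParam h]

lemma side_meet_swap {i j : Fin n} (h : i ≠ j) (k : Fin n) :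
    A.side k (A.meet h) = A.side k (A.meet h.symm) := by
  rw [coe_meet, coe_meet, A.curve_crossParam_eq h]

lemma exists_side_eq_zero (v : A.vertexSet) :
    ∃ i j, i ≠ j ∧ A.side i v = 0 ∧ A.side j v = 0 := by
  obtain ⟨v, i, j, h, hi, hj⟩ := v
  exact ⟨i, j, h, A.side_eq_zero_iff.2 hi, A.side_eq_zero_iff.2 hj⟩

lemma exists_curve_eq {i : Fin n} {p : Plane} (h : A.side i p = 0) :
    ∃ t, (A.line i).curve t = p := A.side_eq_zero_iff.1 h

lemma curve_mem_vertexSet_iff {i : Fin n} {t : ℝ} :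
    (A.line i).curve t ∈ A.vertexSet ↔ ∃ j, i ≠ j ∧ t = A.crossParam i j := by
  constructor
  · intro h
    obtain ⟨a, b, hab, ha, hb⟩ := A.exists_side_eq_zero ⟨_, h⟩
    by_cases hia : i = a
    · subst hia
      exact ⟨b, hab, (A.side_curve_eq_zero_iff hab).1 hb⟩
    · exact ⟨a, hia, (A.side_curve_eq_zero_iff hia).1 ha⟩
  · rintro ⟨j, hij, rfl⟩
    exact A.coe_meet hij ▸ (A.meet hij).2

/-- Sides vary monotonically along a pseudoline. -/
lemma side_between {i : Fin n} {s u t : ℝ} (hsu : s ≤ u) (hut : u ≤ t) (j : Fin n) :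
    |A.side j ((A.line i).curve s) - A.side j ((A.line i).curve u)| +
      |A.side j ((A.line i).curve u) - A.side j ((A.line i).curve t)| =
      |A.side j ((A.line i).curve s) - A.side j ((A.line i).curve t)| := by
  by_cases hij : i = j
  · subst hij; simp [side_curve_self]
  have ho := A.orient_cases hij
  rcases lt_trichotomy s (A.crossParam i j) with hs | hs | hs <;>
  rcases lt_trichotomy u (A.crossParam i j) with hu | hu | hu <;>
  rcases lt_trichotomy t (A.crossParam i j) with ht | ht | ht <;>
  first
  | (exfalso; linarith)
  | (first
      | rw [A.side_curve_of_lt hij hs] | rw [A.side_curve_of_gt hij hs]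
      | rw [(A.side_curve_eq_zero_iff hij).2 hs]
     first
      | rw [A.side_curve_of_lt hij hu] | rw [A.side_curve_of_gt hij hu]
      | rw [(A.side_curve_eq_zero_iff hij).2 hu]
     first
      | rw [A.side_curve_of_lt hij ht] | rw [A.side_curve_of_gt hij ht]
      | rw [(A.side_curve_eq_zero_iff hij).2 ht]
     rcases ho with ho | ho <;> simp [ho])

end SimpleArrangement

/-- From the last vertex of a walk with a given property, the rest of the walk avoids the
property. -/
lemma SimpleGraph.Walk.exists_last {V : Type*} {G : SimpleGraph V} (S : V → Prop) {p q : V}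
    (w : G.Walk p q) (h : ∃ v ∈ w.support, S v) :
    ∃ z ∈ w.support, S z ∧ ∃ w' : G.Walk z q, w'.support ⊆ w.support ∧
      ∀ v ∈ w'.support, S v → v = z := by
  induction w with
  | nil =>
    obtain ⟨v, hv, hS⟩ := h
    refine ⟨v, hv, hS, ?_⟩
    rw [SimpleGraph.Walk.support_nil, List.mem_singleton] at hv
    subst hv
    exact ⟨.nil, by simp, by simp⟩
  | cons hadj w ih =>
    by_cases hw : ∃ v ∈ w.support, S v
    · obtain ⟨z, hz, hSz, w', hsub, hlast⟩ := ih hw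
      exact ⟨z, by simp [hz], hSz, w', fun v hv => by simp [hsub hv], hlast⟩
    · push Not at hw
      obtain ⟨v, hv, hS⟩ := h
      rw [SimpleGraph.Walk.support_cons, List.mem_cons] at hv
      rcases hv with rfl | hv
      · refine ⟨_, by simp, hS, .cons hadj w, fun v hv => hv, ?_⟩
        intro v hv hSv
        rw [SimpleGraph.Walk.support_cons, List.mem_cons] at hv
        rcases hv with rfl | hv
        · rfl
        · exact absurd hSv (hw v hv)
      · exact absurd hS (hw v hv)

/-! ### Separation count, betweenness and the lower bound for distances -/

namespace SimpleArrangement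

variable {n : ℕ} (A : SimpleArrangement n)

/-- The number of pseudolines between two points, those through just one of them counted once and
those strictly separating them counted twice. -/
noncomputable def sepDist (p q : Plane) : ℤ := ∑ j, |A.side j p - A.side j q|

/-- The point `v` lies between `x` and `y` with respect to every pseudoline. -/
def Between (x v y : Plane) : Prop :=
  ∀ j, |A.side j x - A.side j v| + |A.side j v - A.side j y| = |A.side j x - A.side j y|

variable {A}

lemma Between.symm {x v y : Plane} (h : A.Between x v y) : A.Between y v x := by
  intro j
  rw [abs_sub_comm (A.side j y) (A.side j v), abs_sub_comm (A.side j v) (A.side j x),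
    abs_sub_comm (A.side j y), add_comm]
  exact h j

lemma Between.trans {x u v y : Plane} (h : A.Between x u y) (h' : A.Between u v y) :
    A.Between x v y := by
  intro j
  have h1 := h j
  have h2 := h' j
  have h3 := abs_sub_le (A.side j x) (A.side j u) (A.side j v)
  have h4 := abs_sub_le (A.side j x) (A.side j v) (A.side j y)
  linarith

lemma Between.sepDist {x v y : Plane} (h : A.Between x v y) :
    A.sepDist x v + A.sepDist v y = A.sepDist x y := by
  simp only [SimpleArrangement.sepDist, ← Finset.sum_add_distrib]
  exact Finset.sum_congr rfl fun j _ => h j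

lemma Between.side_eq {x v y : Plane} (h : A.Between x v y) {j : Fin n}
    (hxy : A.side j x = A.side j y) : A.side j v = A.side j x := by
  have := h j
  rw [hxy, sub_self, abs_zero, abs_sub_comm] at this
  have h0 := abs_nonneg (A.side j v - A.side j y)
  have h1 : |A.side j v - A.side j y| = 0 := by linarith
  rw [abs_eq_zero] at h1
  linarith

lemma Between.side_eq_right {x v y : Plane} (h : A.Between x v y) {j : Fin n}
    (hx : A.side j x = 0) (hv : A.side j v ≠ 0) : A.side j v = A.side j y := by
  have := h j
  rw [hx] at this
  rcases A.side_cases j v with h1 | h1 | h1 <;> rcases A.side_cases j y with h2 | h2 | h2 <;>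
    simp_all

lemma Between.separates {x v y : Plane} (h : A.Between x v y) {j : Fin n}
    (hv : A.side j v = 0) : A.side j x = 0 ∨ A.side j y ≠ A.side j x := by
  by_cases hxy : A.side j x = A.side j y
  · left
    rw [← h.side_eq hxy, hv]
  · exact Or.inr (Ne.symm hxy)

variable (A)

lemma between_self_left (x y : Plane) : A.Between x x y := fun _ => by simp

lemma sepDist_triangle (x v y : Plane) : A.sepDist x y ≤ A.sepDist x v + A.sepDist v y := by
  simp only [sepDist, ← Finset.sum_add_distrib]
  exact Finset.sum_le_sum fun _ _ => abs_sub_le _ _ _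

lemma sepDist_nonneg (x y : Plane) : 0 ≤ A.sepDist x y :=
  Finset.sum_nonneg fun _ _ => abs_nonneg _

lemma sepDist_self (x : Plane) : A.sepDist x x = 0 := by simp [sepDist]

lemma sepDist_comm (x y : Plane) : A.sepDist x y = A.sepDist y x := by
  simp only [sepDist, abs_sub_comm (A.side _ x)]

lemma between_of_mem_uIcc {i : Fin n} {s u t : ℝ} (hu : u ∈ Set.uIcc s t) :
    A.Between ((A.line i).curve s) ((A.line i).curve u) ((A.line i).curve t) := by
  rcases Set.mem_uIcc.1 hu with ⟨h1, h2⟩ | ⟨h1, h2⟩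
  · exact A.side_between h1 h2
  · exact Between.symm (A.side_between h1 h2)

lemma side_eq_of_no_vertex {i a b j : Fin n} (hia : i ≠ a) (hib : i ≠ b)
    (hlt : A.crossParam i a < A.crossParam i b)
    (h : ∀ u ∈ Set.Ioo (A.crossParam i a) (A.crossParam i b), (A.line i).curve u ∉ A.vertexSet)
    (hja : j ≠ a) (hjb : j ≠ b) :
    A.side j ((A.line i).curve (A.crossParam i a)) =
      A.side j ((A.line i).curve (A.crossParam i b)) := by
  by_cases hij : i = j
  · subst hij; simp [side_curve_self]
  have h1 : A.crossParam i j ≠ A.crossParam i a := fun e => hja (A.crossParam_injective hij hia e)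
  have h2 : A.crossParam i j ≠ A.crossParam i b := fun e => hjb (A.crossParam_injective hij hib e)
  rcases lt_or_gt_of_ne h1 with h1 | h1
  · rw [A.side_curve_of_gt hij h1, A.side_curve_of_gt hij (h1.trans hlt)]
  rcases lt_or_gt_of_ne h2 with h2 | h2
  · exact absurd (A.curve_mem_vertexSet_iff.2 ⟨j, hij, rfl⟩) (h _ ⟨h1, h2⟩)
  · rw [A.side_curve_of_lt hij (hlt.trans h2), A.side_curve_of_lt hij h2]

/-- Only the sign of `a` leaves 0 and only that of `b` reaches 0; each contributes 1, and no other
sign changes before the next vertex. -/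
lemma sepDist_eq_two_of_lt {i a b : Fin n} (hia : i ≠ a) (hib : i ≠ b)
    (hlt : A.crossParam i a < A.crossParam i b)
    (h : ∀ u ∈ Set.Ioo (A.crossParam i a) (A.crossParam i b), (A.line i).curve u ∉ A.vertexSet) :
    A.sepDist ((A.line i).curve (A.crossParam i a)) ((A.line i).curve (A.crossParam i b)) = 2 := by
  have hab : a ≠ b := by rintro rfl; exact lt_irrefl _ hlt
  rw [sepDist, ← Finset.sum_subset (Finset.subset_univ {a, b}), Finset.sum_pair hab,
    A.side_curve_crossParam hia, A.side_curve_crossParam hib, A.side_curve_of_lt hib hlt,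
    A.side_curve_of_gt hia hlt]
  · rcases A.orient_cases hia with h1 | h1 <;> rcases A.orient_cases hib with h2 | h2 <;>
      simp [h1, h2]
  · intro j _ hj
    simp only [Finset.mem_insert, Finset.mem_singleton, not_or] at hj
    rw [A.side_eq_of_no_vertex hia hib hlt h hj.1 hj.2]
    simp

lemma adj_iff_exists_lt {p q : A.vertexSet} (h : A.graph.Adj p q) :
    ∃ i a b, i ≠ a ∧ i ≠ b ∧ A.crossParam i a < A.crossParam i b ∧
      (∀ u ∈ Set.Ioo (A.crossParam i a) (A.crossParam i b),
        (A.line i).curve u ∉ A.vertexSet) ∧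
      (((p : Plane) = (A.line i).curve (A.crossParam i a) ∧
        (q : Plane) = (A.line i).curve (A.crossParam i b)) ∨
      ((q : Plane) = (A.line i).curve (A.crossParam i a) ∧
        (p : Plane) = (A.line i).curve (A.crossParam i b))) := by
  obtain ⟨hne, i, s, t, hs, ht, hu⟩ := h
  obtain ⟨a, hia, rfl⟩ := A.curve_mem_vertexSet_iff.1 (hs ▸ p.2)
  obtain ⟨b, hib, rfl⟩ := A.curve_mem_vertexSet_iff.1 (ht ▸ q.2)
  rcases lt_trichotomy (A.crossParam i a) (A.crossParam i b) with hl | hl | hl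
  · rw [min_eq_left hl.le, max_eq_right hl.le] at hu
    exact ⟨i, a, b, hia, hib, hl, hu, Or.inl ⟨hs.symm, ht.symm⟩⟩
  · exact absurd (Subtype.ext (hs.symm.trans ((congrArg _ hl).trans ht))) hne
  · rw [min_eq_right hl.le, max_eq_left hl.le] at hu
    exact ⟨i, b, a, hib, hia, hl, hu, Or.inr ⟨ht.symm, hs.symm⟩⟩

lemma sepDist_eq_two_of_adj {p q : A.vertexSet} (h : A.graph.Adj p q) : A.sepDist p q = 2 := by
  obtain ⟨i, a, b, hia, hib, hlt, hu, ⟨hp, hq⟩ | ⟨hq, hp⟩⟩ := A.adj_iff_exists_lt h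
  · rw [hp, hq, A.sepDist_eq_two_of_lt hia hib hlt hu]
  · rw [hp, hq, A.sepDist_comm, A.sepDist_eq_two_of_lt hia hib hlt hu]

lemma side_eq_of_adj {p q : A.vertexSet} (h : A.graph.Adj p q) {j : Fin n}
    (hp : A.side j p ≠ 0) (hq : A.side j q ≠ 0) : A.side j p = A.side j q := by
  obtain ⟨i, a, b, hia, hib, hlt, hu, ⟨hp', hq'⟩ | ⟨hq', hp'⟩⟩ := A.adj_iff_exists_lt h <;>
  · rw [hp'] at hp ⊢
    rw [hq'] at hq ⊢
    have hja : j ≠ a := by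
      rintro rfl
      first
      | exact hp (A.side_curve_crossParam hia)
      | exact hq (A.side_curve_crossParam hia)
    have hjb : j ≠ b := by
      rintro rfl
      first
      | exact hp (A.side_curve_crossParam hib)
      | exact hq (A.side_curve_crossParam hib)
    first
    | exact A.side_eq_of_no_vertex hia hib hlt hu hja hjb
    | exact (A.side_eq_of_no_vertex hia hib hlt hu hja hjb).symm

lemma exists_common_of_adj {p q : A.vertexSet} (h : A.graph.Adj p q) :
    ∃ i, A.side i p = 0 ∧ A.side i q = 0 := by
  obtain ⟨-, i, s, t, hs, ht, -⟩ := h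
  exact ⟨i, by rw [← hs, side_curve_self], by rw [← ht, side_curve_self]⟩

lemma sepDist_le_length {p q : A.vertexSet} (w : A.graph.Walk p q) :
    A.sepDist p q ≤ 2 * w.length := by
  induction w with
  | nil => simp [sepDist_self]
  | @cons u v _ h w ih =>
    have h1 := A.sepDist_eq_two_of_adj h
    refine (A.sepDist_triangle _ v _).trans ?_
    rw [h1, SimpleGraph.Walk.length_cons]
    push_cast
    linarith

/-- A walk that does not meet a pseudoline stays on one side of it. -/
lemma side_eq_of_walk {p q : A.vertexSet} (w : A.graph.Walk p q) {j : Fin n}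
    (h : ∀ u ∈ w.support, A.side j u ≠ 0) : ∀ u ∈ w.support, A.side j u = A.side j p := by
  induction w with
  | nil => simp
  | cons hadj w ih =>
    simp only [SimpleGraph.Walk.support_cons, List.mem_cons, forall_eq_or_imp] at h ⊢
    refine ⟨trivial, fun u hu => ?_⟩
    rw [ih h.2 u hu]
    exact (A.side_eq_of_adj hadj h.1 (h.2 _ w.start_mem_support)).symm

/-! ### Walks along pseudolines and the upper bound n - 2 -/

/-- On a pseudoline, each vertex has a neighbour in the direction of any other vertex. -/
lemma exists_adj_toward {i : Fin n} {x y : A.vertexSet} (hxy : x ≠ y) (hx : A.side i x = 0)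
    (hy : A.side i y = 0) : ∃ x', A.graph.Adj x x' ∧ A.side i x' = 0 ∧ A.Between x x' y := by
  obtain ⟨s, hs⟩ := A.exists_curve_eq hx
  obtain ⟨t, ht⟩ := A.exists_curve_eq hy
  have hst : t ≠ s := by
    rintro rfl
    exact hxy (Subtype.ext (hs.symm.trans ht))
  obtain ⟨k, hik, hk⟩ := A.curve_mem_vertexSet_iff.1 (ht ▸ y.2)
  classical
  obtain ⟨j, hj, hmin⟩ := Finset.exists_min_image
    (Finset.univ.filter fun j => i ≠ j ∧ A.crossParam i j ≠ s ∧ A.crossParam i j ∈ Set.uIcc s t)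
    (fun j => |A.crossParam i j - s|)
    ⟨k, by simp only [Finset.mem_filter, Finset.mem_univ, true_and, ← hk]
           exact ⟨hik, hst, Set.right_mem_uIcc⟩⟩
  simp only [Finset.mem_filter, Finset.mem_univ, true_and] at hj hmin
  obtain ⟨hij, hjs, hjm⟩ := hj
  refine ⟨A.meet hij, ⟨?_, i, s, A.crossParam i j, hs, (A.coe_meet hij).symm, ?_⟩, A.side_meet_left hij, ?_⟩
  · intro e
    have : (A.line i).curve s = (A.line i).curve (A.crossParam i j) :=
      hs.trans ((congrArg Subtype.val e).trans (A.coe_meet hij))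
    exact hjs ((A.line i).curve_injective this).symm
  · intro u hu hv
    obtain ⟨l, hil, rfl⟩ := A.curve_mem_vertexSet_iff.1 hv
    have hmem : A.crossParam i l ∈ Set.uIcc s t :=
      Set.uIcc_subset_uIcc Set.left_mem_uIcc hjm ⟨hu.1.le, hu.2.le⟩
    have hls : A.crossParam i l ≠ s ∧ |A.crossParam i l - s| < |A.crossParam i j - s| := by
      rcases lt_or_gt_of_ne hjs with h | h
      · rw [min_eq_right h.le, max_eq_left h.le] at hu
        obtain ⟨h1, h2⟩ := hu
        rw [abs_of_neg (by linarith), abs_of_neg (by linarith)]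
        exact ⟨h2.ne, by linarith⟩
      · rw [min_eq_left h.le, max_eq_right h.le] at hu
        obtain ⟨h1, h2⟩ := hu
        rw [abs_of_pos (by linarith), abs_of_pos (by linarith)]
        exact ⟨h1.ne', by linarith⟩
    exact absurd (hmin l ⟨hil, hls.1, hmem⟩) (not_le.2 hls.2)
  · rw [← hs, ← ht, A.coe_meet]
    exact A.between_of_mem_uIcc hjm

/-- The walk along a pseudoline from one of its vertices to another. -/
lemma exists_segment {i : Fin n} {x y : A.vertexSet} (hx : A.side i x = 0)
    (hy : A.side i y = 0) : ∃ w : A.graph.Walk x y,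
      ∀ v ∈ w.support, A.side i v = 0 ∧ A.Between x v y := by
  -- Every step toward `y` lowers the `sepDist` to `y` by 2, so the induction is on a bound for it.
  suffices H : ∀ k : ℕ, ∀ x : A.vertexSet, A.side i x = 0 → A.sepDist x y ≤ k →
      ∃ w : A.graph.Walk x y, ∀ v ∈ w.support, A.side i v = 0 ∧ A.Between x v y from
    H (A.sepDist x y).toNat x hx (Int.self_le_toNat _)
  intro k
  induction k using Nat.strong_induction_on with
  | _ k ih =>
    intro x hx hk
    by_cases hxy : x = y
    · subst hxy
      refine ⟨.nil, fun v hv => ?_⟩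
      rw [SimpleGraph.Walk.support_nil, List.mem_singleton] at hv
      subst hv
      exact ⟨hx, A.between_self_left _ _⟩
    obtain ⟨x', hadj, hx', hbet⟩ := A.exists_adj_toward hxy hx hy
    have hd := hbet.sepDist
    rw [A.sepDist_eq_two_of_adj hadj] at hd
    have hnn := A.sepDist_nonneg x' y
    obtain ⟨w, hw⟩ := ih (k - 2) (by omega) x' hx' (by omega)
    refine ⟨.cons hadj w, fun v hv => ?_⟩
    rw [SimpleGraph.Walk.support_cons, List.mem_cons] at hv
    rcases hv with rfl | hv
    · exact ⟨hx, A.between_self_left _ _⟩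
    · exact ⟨(hw v hv).1, hbet.trans (hw v hv).2⟩

lemma reachable (p q : A.vertexSet) : A.graph.Reachable p q := by
  obtain ⟨a, b, hab, ha, hb⟩ := A.exists_side_eq_zero p
  obtain ⟨c, d, hcd, hc, hd⟩ := A.exists_side_eq_zero q
  by_cases hac : a = c
  · subst hac
    exact (A.exists_segment ha hc).choose.reachable
  · exact (A.exists_segment ha (A.side_meet_left hac)).choose.reachable.trans
      (A.exists_segment (A.side_meet_right hac) hc).choose.reachable

/-- A walk from `p` can be left for the last time along one of the two pseudolines through `p`,
after which it avoids the other one. -/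
lemma exists_leave {p q : A.vertexSet} (hpq : p ≠ q) (w : A.graph.Walk p q) :
    ∃ a b, a ≠ b ∧ A.side a p = 0 ∧ A.side b p = 0 ∧ ∃ z ∈ w.support, z ≠ p ∧ A.side a z = 0 ∧
      ∃ w₂ : A.graph.Walk z q, w₂.support ⊆ w.support ∧ ∀ v ∈ w₂.support, A.side b v ≠ 0 := by
  obtain ⟨a, b, hab, ha, hb⟩ := A.exists_side_eq_zero p
  obtain ⟨z, hz, hS, w₂, hsub, hlast⟩ := w.exists_last
    (fun v : A.vertexSet => A.side a v = 0 ∨ A.side b v = 0) ⟨p, w.start_mem_support, Or.inl ha⟩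
  -- Every edge at `p` lies on `a` or `b`, so the vertex after a last visit at `p` would still be on
  -- one of them.
  have hzp : z ≠ p := by
    rintro rfl
    cases w₂ with
    | nil => exact hpq rfl
    | @cons _ u _ hadj w₃ =>
      obtain ⟨i, hi, hi'⟩ := A.exists_common_of_adj hadj
      have hu : A.side a u = 0 ∨ A.side b u = 0 := by
        rcases A.eq_or_eq_of_side_eq_zero hab ha hb hi with rfl | rfl
        · exact Or.inl hi'
        · exact Or.inr hi'
      exact hadj.1 (hlast u (by simp) hu).symm
  rcases hS with h | h
  · refine ⟨a, b, hab, ha, hb, z, hz, hzp, h, w₂, hsub, fun v hv hbv => hzp ?_⟩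
    rw [hlast v hv (Or.inr hbv)] at hbv
    exact Subtype.ext (A.eq_of_side_eq_zero hab h hbv ha hb)
  · refine ⟨b, a, hab.symm, hb, ha, z, hz, hzp, h, w₂, hsub, fun v hv hav => hzp ?_⟩
    rw [hlast v hv (Or.inl hav)] at hav
    exact Subtype.ext (A.eq_of_side_eq_zero hab hav h ha hb)

/-- A walk all of whose vertices lie only on pseudolines from `H` can be replaced by one of length
at most `#H - 2`. -/
lemma exists_walk_length_add_two_le (H : Finset (Fin n)) {p q : A.vertexSet}
    (w : A.graph.Walk p q) (hw : ∀ v ∈ w.support, ∀ j, A.side j v = 0 → j ∈ H) :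
    ∃ w' : A.graph.Walk p q, w'.length + 2 ≤ H.card := by
  induction hk : H.card generalizing H p q with
  | zero =>
    obtain ⟨a, b, hab, ha, hb⟩ := A.exists_side_eq_zero p
    have := hw p w.start_mem_support a ha
    rw [Finset.card_eq_zero] at hk
    simp [hk] at this
  | succ k ih =>
    obtain ⟨a, b, hab, ha, hb⟩ := A.exists_side_eq_zero p
    by_cases hpq : p = q
    · subst hpq
      refine ⟨.nil, ?_⟩
      have haH := hw p w.start_mem_support a ha
      have hbH := hw p w.start_mem_support b hb
      have : 1 < H.card := Finset.one_lt_card.2 ⟨a, haH, b, hbH, hab⟩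
      simp only [SimpleGraph.Walk.length_nil]
      omega
    obtain ⟨a, b, hab, ha, hb, z, hz, hzp, haz, w₂, hsub, hw₂⟩ := A.exists_leave hpq w
    have hbz : A.side b z ≠ 0 := hw₂ z w₂.start_mem_support
    obtain ⟨p', hadj, hap', hbet⟩ := A.exists_adj_toward hzp.symm ha haz
    obtain ⟨r, hr⟩ := A.exists_segment hap' haz
    have hbp' : A.side b p' ≠ 0 := fun h =>
      hadj.1 (Subtype.ext (A.eq_of_side_eq_zero hab ha hb hap' h))
    have hbH : b ∈ H := hw p w.start_mem_support b hb
    -- The new walk from `p'` runs straight along `a` to `z`, then follows `w`. It misses `b`,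
    -- because `p'` is already on the side of `b` that contains `z`.
    obtain ⟨w', hw'⟩ := ih (H.erase b) (r.append w₂) (by
      intro v hv j hj
      rw [SimpleGraph.Walk.mem_support_append_iff] at hv
      rcases hv with hv | hv
      · obtain ⟨hav, hbv⟩ := hr v hv
        refine Finset.mem_erase.2 ⟨?_, ?_⟩
        · rintro rfl
          have h1 := hbet.side_eq_right hb hbp'
          rw [hbv.side_eq h1] at hj
          exact hbp' hj
        · by_contra hjH
          -- If `w` misses `j`, then `p` and `z` are on one side of `j`, and so is the piece of `a`
          -- between them.
          have hne : ∀ u ∈ w.support, A.side j u ≠ 0 := fun u hu h => hjH (hw u hu j h)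
          have hz' := A.side_eq_of_walk w hne z hz
          have := (hbet.trans hbv).side_eq hz'.symm
          rw [hj] at this
          exact hne p w.start_mem_support this.symm
      · refine Finset.mem_erase.2 ⟨?_, hw v (hsub hv) j hj⟩
        rintro rfl
        exact hw₂ v hv hj) (by rw [Finset.card_erase_of_mem hbH]; omega)
    exact ⟨.cons hadj w', by rw [SimpleGraph.Walk.length_cons]; omega⟩

lemma exists_walk_length_le (p q : A.vertexSet) : ∃ w : A.graph.Walk p q, w.length + 2 ≤ n := by
  obtain ⟨w⟩ := A.reachable p q
  simpa using A.exists_walk_length_add_two_le Finset.univ w (by simp)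

/-- Avoiding a single pseudoline already beats the bound n - 2; this is what must fail for every
walk between two vertices at distance n - 2. -/
lemma exists_walk_of_avoid {p q : A.vertexSet} (w : A.graph.Walk p q) {f : Fin n}
    (hw : ∀ v ∈ w.support, A.side f v ≠ 0) : ∃ w : A.graph.Walk p q, w.length + 3 ≤ n := by
  obtain ⟨w', h⟩ := A.exists_walk_length_add_two_le (Finset.univ.erase f) w (by
    intro v hv j hj
    simp only [Finset.mem_erase, Finset.mem_univ, and_true]
    rintro rfl
    exact hw v hv hj)
  refine ⟨w', ?_⟩
  rw [Finset.card_erase_of_mem (Finset.mem_univ _), Finset.card_univ, Fintype.card_fin] at h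
  have := f.pos
  omega

/-! ### Tails and the avoidance of wrapping pseudolines -/

/-- A point of one of the two unbounded end segments of the `l`-th pseudoline. -/
def IsTailPoint (l : Fin n) (x : Plane) : Prop :=
  ∃ t, x = (A.line l).curve t ∧
    ((∀ j, l ≠ j → t < A.crossParam l j) ∨ (∀ j, l ≠ j → A.crossParam l j < t))

/-- No pseudoline strictly separates the two points. -/
def Compatible (p q : Plane) : Prop := ∀ j, A.side j p = 0 ∨ A.side j q = 0 ∨
  A.side j p = A.side j q

/-- If two pseudolines meet a third one in different directions from its vertex `p`, and they meet
each other on the side of it that a walk starting in `p` avoids, then one of them can be avoided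
on the way to the end of the walk. -/
lemma exists_short_walk_of_wrapping {p q : A.vertexSet} {b e f : Fin n} (w : A.graph.Walk p q)
    {β : ℤ} (hβ : β ≠ 0) (hbp : A.side b p = 0)
    (hw : ∀ v ∈ w.support, v = p ∨ A.side b v = β) (hbe : b ≠ e) (hbf : b ≠ f) (hef : e ≠ f)
    (hep : A.side e p ≠ 0) (hfp : A.side f p ≠ 0)
    (he : A.side e (A.meet hbf) = A.side e p) (hf : A.side f (A.meet hbe) = A.side f p)
    (hmeet : A.side b (A.meet hef) = -β) : ∃ w : A.graph.Walk p q, w.length + 3 ≤ n := by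
  by_cases hS : ∃ v ∈ w.support, A.side e v = 0 ∨ A.side f v = 0
  swap
  · push Not at hS
    exact A.exists_walk_of_avoid w fun v hv => (hS v hv).1
  -- Detour along `b` to `e`, along `e` to `z`, then along the end of `w`. It misses `f`: on `b`
  -- both ends are on one side of `f`, and the piece of `e` used is on `b` or on side `β`, whereas
  -- `e` meets `f` on side `-β`.
  have key : ∀ e f : Fin n, ∀ (hbe : b ≠ e) (hef : e ≠ f), A.side e p ≠ 0 →
      A.side f p ≠ 0 → A.side f (A.meet hbe) = A.side f p → A.side b (A.meet hef) = -β →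
      ∀ z ∈ w.support, A.side e z = 0 → ∀ w₂ : A.graph.Walk z q, w₂.support ⊆ w.support →
      (∀ v ∈ w₂.support, A.side f v = 0 → v = z) →
      ∃ w : A.graph.Walk p q, w.length + 3 ≤ n := by
    intro e f hbe hef hep hfp hf hmeet z hz hez w₂ hsub hlast
    have hbz : A.side b z = β := by
      rcases hw z hz with rfl | h
      · exact absurd hez hep
      · exact h
    have hnot : ∀ v : A.vertexSet, A.side e v = 0 → A.side f v = 0 → A.side b v = -β := by
      intro v h1 h2
      rw [← hmeet, A.eq_of_side_eq_zero hef h1 h2 (A.side_meet_left hef) (A.side_meet_right hef)]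
    obtain ⟨w₃, hw₃⟩ := A.exists_segment hbp (A.side_meet_left hbe)
    obtain ⟨w₄, hw₄⟩ := A.exists_segment (A.side_meet_right hbe) hez
    refine A.exists_walk_of_avoid (f := f) (w₃.append (w₄.append w₂)) fun v hv => ?_
    rw [SimpleGraph.Walk.mem_support_append_iff, SimpleGraph.Walk.mem_support_append_iff] at hv
    rcases hv with hv | hv | hv
    · rw [(hw₃ v hv).2.side_eq hf.symm]
      exact hfp
    · intro hfv
      have h1 := hnot v (hw₄ v hv).1 hfv
      have h2 := (hw₄ v hv).2.side_eq_right (A.side_meet_left hbe) (by rw [h1]; exact neg_ne_zero.2 hβ)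
      rw [h1, hbz] at h2
      exact hβ (self_eq_neg.1 h2.symm)
    · intro hfv
      have hvz := hlast v hv hfv
      subst hvz
      have h1 := hnot v hez hfv
      rw [hbz] at h1
      exact hβ (self_eq_neg.1 h1)
  obtain ⟨z, hz, hSz, w₂, hsub, hlast⟩ := w.exists_last _ hS
  rcases hSz with h | h
  · exact key e f hbe hef hep hfp hf hmeet z hz h w₂ hsub fun v hv hv' => hlast v hv (Or.inr hv')
  · refine key f e hbf hef.symm hfp hep he ?_ z hz h w₂ hsub
      fun v hv hv' => hlast v hv (Or.inl hv')
    rw [← hmeet, A.side_meet_swap hef]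

lemma side_curve_eq {i j : Fin n} (hij : i ≠ j) {s t : ℝ}
    (h : (s < A.crossParam i j ∧ t < A.crossParam i j) ∨
      (A.crossParam i j < s ∧ A.crossParam i j < t)) :
    A.side j ((A.line i).curve s) = A.side j ((A.line i).curve t) := by
  rcases h with ⟨h1, h2⟩ | ⟨h1, h2⟩
  · rw [A.side_curve_of_lt hij h1, A.side_curve_of_lt hij h2]
  · rw [A.side_curve_of_gt hij h1, A.side_curve_of_gt hij h2]

lemma side_curve_eq_neg {i j : Fin n} (hij : i ≠ j) {s t : ℝ}
    (h : (s < A.crossParam i j ∧ A.crossParam i j < t) ∨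
      (A.crossParam i j < s ∧ t < A.crossParam i j)) :
    A.side j ((A.line i).curve s) = -A.side j ((A.line i).curve t) := by
  rcases h with ⟨h1, h2⟩ | ⟨h1, h2⟩
  · rw [A.side_curve_of_lt hij h1, A.side_curve_of_gt hij h2]
  · rw [A.side_curve_of_gt hij h1, A.side_curve_of_lt hij h2, neg_neg]

lemma crossParam_ne {i j k : Fin n} (hij : i ≠ j) (hik : i ≠ k) (hjk : j ≠ k) :
    A.crossParam i j ≠ A.crossParam i k := fun h => hjk (A.crossParam_injective hij hik h)

/-- A point of the `i`-th pseudoline that is not on the side `β` of the `m`-th one and a point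
that is lie at different ends of the crossing, which only the former may equal. -/
lemma le_or_le_of_side {i m : Fin n} (him : i ≠ m) {β : ℤ} (hβ : β ≠ 0) {c s : ℝ}
    (hc : A.side m ((A.line i).curve c) = β)
    (hs : A.side m ((A.line i).curve s) ≠ β) :
    (A.crossParam i m < c ∧ s ≤ A.crossParam i m) ∨
      (c < A.crossParam i m ∧ A.crossParam i m ≤ s) := by
  rcases lt_trichotomy c (A.crossParam i m) with h | h | h
  · refine Or.inr ⟨h, not_lt.1 fun h' => hs ?_⟩
    rw [← hc, A.side_curve_eq him (Or.inl ⟨h', h⟩)]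
  · rw [h, A.side_curve_crossParam him] at hc
    exact absurd hc.symm hβ
  · refine Or.inl ⟨h, not_lt.1 fun h' => hs ?_⟩
    rw [← hc, A.side_curve_eq him (Or.inr ⟨h', h⟩)]

lemma lt_and_lt_or_of_side {i m : Fin n} (him : i ≠ m) {β : ℤ} (hβ : β ≠ 0) {c s : ℝ}
    (hc : A.side m ((A.line i).curve c) = β) (hs : A.side m ((A.line i).curve s) = β) :
    (A.crossParam i m < c ∧ A.crossParam i m < s) ∨
      (c < A.crossParam i m ∧ s < A.crossParam i m) := by
  have h0 : A.side m ((A.line i).curve (A.crossParam i m)) ≠ β := by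
    rw [A.side_curve_crossParam him]; exact hβ.symm
  rcases A.le_or_le_of_side him hβ hc h0 with ⟨h1, -⟩ | ⟨h1, -⟩ <;>
  rcases A.le_or_le_of_side him hβ hs h0 with ⟨h2, -⟩ | ⟨h2, -⟩
  · exact Or.inl ⟨h1, h2⟩
  · have := A.side_curve_eq_neg him (Or.inr ⟨h1, h2⟩)
    omega
  · have := A.side_curve_eq_neg him (Or.inl ⟨h1, h2⟩)
    omega
  · exact Or.inr ⟨h1, h2⟩

/-- The part of `i` outside side `β` of `m` is a ray that does not contain the crossing with `j`, so
`j` cannot separate two of its points. -/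
lemma side_eq_of_side_meet {i j m : Fin n} (hij : i ≠ j) (him : i ≠ m) {β : ℤ} (hβ : β ≠ 0)
    (hmeet : A.side m (A.meet hij) = β) {x y : Plane} (hx : A.side i x = 0) (hy : A.side i y = 0)
    (hmx : A.side m x ≠ β) (hmy : A.side m y ≠ β) : A.side j x = A.side j y := by
  rw [coe_meet] at hmeet
  obtain ⟨s, rfl⟩ := A.exists_curve_eq hx
  obtain ⟨t, rfl⟩ := A.exists_curve_eq hy
  apply A.side_curve_eq hij
  rcases A.le_or_le_of_side him hβ hmeet hmx with ⟨h1, h2⟩ | ⟨h1, h2⟩ <;>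
  rcases A.le_or_le_of_side him hβ hmeet hmy with ⟨h3, h4⟩ | ⟨h3, h4⟩
  · exact Or.inl ⟨by linarith, by linarith⟩
  · linarith
  · linarith
  · exact Or.inr ⟨by linarith, by linarith⟩

/-- Going along `j` from `m`, whichever of `i` and `k` comes first has been crossed by the time the
other is reached. -/
lemma side_meet_eq_neg_or {i j k m : Fin n} (hji : j ≠ i) (hjk : j ≠ k) (hjm : j ≠ m) (hik : i ≠ k)
    {β : ℤ} (hβ : β ≠ 0) (hi : A.side m (A.meet hji) = β) (hk : A.side m (A.meet hjk) = β) :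
    A.side i (A.meet hjk) = -A.side i (A.meet hjm) ∨
      A.side k (A.meet hji) = -A.side k (A.meet hjm) := by
  have hne := A.crossParam_ne hji hjk hik
  simp only [coe_meet] at hi hk ⊢
  rcases A.lt_and_lt_or_of_side hjm hβ hi hk with ⟨h1, h2⟩ | ⟨h1, h2⟩ <;>
  rcases lt_or_gt_of_ne hne with h | h
  · exact Or.inl (A.side_curve_eq_neg hji (Or.inr ⟨h, h1⟩))
  · exact Or.inr (A.side_curve_eq_neg hjk (Or.inr ⟨h, h2⟩))
  · exact Or.inr (A.side_curve_eq_neg hjk (Or.inl ⟨h, h2⟩))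
  · exact Or.inl (A.side_curve_eq_neg hji (Or.inl ⟨h, h1⟩))

variable {A}

lemma IsTailPoint.side_self {l : Fin n} {x : Plane} (hx : A.IsTailPoint l x) :
    A.side l x = 0 := by
  obtain ⟨t, rfl, -⟩ := hx
  exact A.side_curve_self _ _

lemma IsTailPoint.side_ne_zero {l j : Fin n} (hlj : l ≠ j) {x : Plane} (hx : A.IsTailPoint l x) :
    A.side j x ≠ 0 := by
  obtain ⟨t, rfl, h⟩ := hx
  rw [Ne, A.side_curve_eq_zero_iff hlj]
  rcases h with h | h
  · exact (h j hlj).ne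
  · exact (h j hlj).ne'

/-- On `l`, the crossing with `j` lies between the crossing with `m` and the tail. -/
lemma IsTailPoint.side_eq_neg {l j m : Fin n} (hlj : l ≠ j) (hlm : l ≠ m) {β : ℤ}
    (hβ : β ≠ 0) {x : Plane} (hx : A.IsTailPoint l x) (hmx : A.side m x = β)
    (hmeet : A.side m (A.meet hlj) = β) : A.side j x = -A.side j (A.meet hlm) := by
  obtain ⟨t, rfl, h⟩ := hx
  rw [coe_meet] at hmeet ⊢
  apply A.side_curve_eq_neg hlj
  rcases A.lt_and_lt_or_of_side hlm hβ hmeet hmx with ⟨h1, h2⟩ | ⟨h1, h2⟩ <;>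
  rcases h with h | h <;> have h3 := h j hlj <;> have h4 := h m hlm
  · linarith
  · exact Or.inr ⟨h3, h1⟩
  · exact Or.inl ⟨h3, h1⟩
  · linarith

variable (A)

lemma exists_tailPoint {l b : Fin n} (hlb : l ≠ b) {β : ℤ} (hβ : β = 1 ∨ β = -1) :
    ∃ x, A.IsTailPoint l x ∧ A.side b x = β := by
  obtain ⟨M, hM⟩ := (Set.finite_range (A.crossParam l)).bddAbove
  obtain ⟨m, hm⟩ := (Set.finite_range (A.crossParam l)).bddBelow
  have h1 : ∀ j, A.crossParam l j < M + 1 := fun j => by linarith [hM ⟨j, rfl⟩]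
  have h2 : ∀ j, m - 1 < A.crossParam l j := fun j => by linarith [hm ⟨j, rfl⟩]
  have ho := A.orient_cases hlb
  by_cases h : A.orient l b = β
  · exact ⟨_, ⟨M + 1, rfl, Or.inr fun j _ => h1 j⟩, by rw [A.side_curve_of_gt hlb (h1 b), h]⟩
  · exact ⟨_, ⟨m - 1, rfl, Or.inl fun j _ => h2 j⟩, by
      rw [A.side_curve_of_lt hlb (h2 b)]; omega⟩

/-! ### The order of the tails in a half-plane -/

/-- The order in which curves leave a half-plane: `d` is the order in which they enter it, `X` says
which of them cross inside, and the two excluded configurations make the exit order transitive. -/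
lemma _root_.exists_minimal_of_inversions {J : Type*} [Finite J] [Nonempty J] {d : J → ℝ}
    (hd : Function.Injective d) {X rel : J → J → Prop} (hX : ∀ i j, X i j → X j i)
    (hC₁ : ∀ i j k, d i < d j → d j < d k → X i k → ¬ X i j → ¬ X j k → False)
    (hC₂ : ∀ i j k, d i < d j → d j < d k → X i j → X j k → ¬ X i k → False)
    (hlt : ∀ j k, d j < d k → (rel j k ↔ ¬ X j k)) (hgt : ∀ j k, d k < d j → (rel j k ↔ X j k))
    (hirr : ∀ j, ¬ rel j j) : ∃ l, ∀ j, ¬ rel j l := by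
  have htrans : ∀ i j k, rel i j → rel j k → rel i k := by
    intro i j k h1 h2
    have nij : i ≠ j := by rintro rfl; exact hirr _ h1
    have njk : j ≠ k := by rintro rfl; exact hirr _ h2
    have sij : X i j ↔ X j i := ⟨hX _ _, hX _ _⟩
    have sjk : X j k ↔ X k j := ⟨hX _ _, hX _ _⟩
    have sik : X i k ↔ X k i := ⟨hX _ _, hX _ _⟩
    have nik : i ≠ k := by
      rintro rfl
      rcases lt_or_gt_of_ne (hd.ne nij) with h | h
      · rw [hlt i j h] at h1
        rw [hgt j i h] at h2
        tauto
      · rw [hgt i j h] at h1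
        rw [hlt j i h] at h2
        tauto
    -- Two of the eight cases are cyclic, hence impossible; in each of the six linear orders a
    -- failure of transitivity is one of the excluded patterns.
    rcases lt_or_gt_of_ne (hd.ne nij) with hij | hij <;>
    rcases lt_or_gt_of_ne (hd.ne njk) with hjk | hjk <;>
    rcases lt_or_gt_of_ne (hd.ne nik) with hik | hik <;>
    first
    | rw [hlt i j hij] at h1
    | rw [hgt i j hij] at h1
    all_goals first
    | rw [hlt j k hjk] at h2
    | rw [hgt j k hjk] at h2
    all_goals first
    | rw [hlt i k hik]
    | rw [hgt i k hik]
    · have := hC₁ i j k hij hjk; tauto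
    · linarith
    · have := hC₂ i k j hik hjk; tauto
    · have := hC₁ k i j hik hij; tauto
    · have := hC₂ j i k hij hik; tauto
    · have := hC₁ j k i hjk hik; tauto
    · linarith
    · have := hC₂ k j i hjk hij; tauto
  have : Std.Irrefl rel := ⟨hirr⟩
  have : IsTrans J rel := ⟨htrans⟩
  obtain ⟨l, -, hl⟩ := (Finite.wellFounded_of_trans_of_irrefl rel).has_min Set.univ
    ⟨Classical.arbitrary J, trivial⟩
  exact ⟨l, fun j => hl j trivial⟩

/-- Among the pseudolines that meet the `b`-th one after the parameter `c` (with respect to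
the direction `σ`), some tail on the side `β` of the `b`-th is not separated from the parameter `c`
by any of them. -/
lemma exists_nearest_tail {b : Fin n} {c σ : ℝ} (hσ : σ = 1 ∨ σ = -1) {β : ℤ}
    (hβ : β = 1 ∨ β = -1) (J : Finset (Fin n)) (hJ : J.Nonempty) (hbJ : ∀ j ∈ J, b ≠ j)
    (hc : ∀ j ∈ J, 0 < σ * (A.crossParam b j - c)) :
    ∃ l ∈ J, ∃ x, A.IsTailPoint l x ∧ A.side b x = β ∧
      ∀ j ∈ J, A.side j x = 0 ∨ A.side j x = A.side j ((A.line b).curve c) := by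
  have hβ0 : β ≠ 0 := by omega
  have hβn : β ≠ -β := by omega
  have hnβ0 : -β ≠ 0 := by omega
  have htail : ∀ j : J, ∃ x, A.IsTailPoint j x ∧ A.side b x = β :=
    fun j => A.exists_tailPoint (hbJ j j.2).symm hβ
  choose τ hτ hτb using htail
  obtain ⟨p, hp⟩ : ∃ p, p = (A.line b).curve c := ⟨_, rfl⟩
  rw [← hp]
  have hpar : ∀ j ∈ J, c ≠ A.crossParam b j := by
    rintro j hj rfl
    simpa using hc j hj
  have hp0 : ∀ j ∈ J, A.side j p ≠ 0 := fun j hj h =>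
    hpar j hj ((A.side_curve_eq_zero_iff (hbJ j hj)).1 (hp ▸ h))
  obtain ⟨d, hd⟩ : ∃ d : J → ℝ, ∀ j, d j = σ * (A.crossParam b j - c) := ⟨_, fun _ => rfl⟩
  have hdinj : Function.Injective d := by
    intro j k h
    by_contra hjk
    apply A.crossParam_ne (hbJ j j.2) (hbJ k k.2) (Subtype.coe_ne_coe.2 hjk)
    rw [hd, hd] at h
    rcases hσ with rfl | rfl <;> linarith
  have hside : ∀ j k : J, (d j < d k → A.side j (A.meet (hbJ k k.2)) = -A.side j p) ∧
      (d k < d j → A.side j (A.meet (hbJ k k.2)) = A.side j p) := by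
    intro j k
    have h1 := hc j j.2
    have h2 := hc k k.2
    rw [hp, A.coe_meet, hd, hd]
    constructor <;> intro h
    · apply A.side_curve_eq_neg (hbJ j j.2)
      rcases hσ with rfl | rfl
      · exact Or.inr ⟨by linarith, by linarith⟩
      · exact Or.inl ⟨by linarith, by linarith⟩
    · apply A.side_curve_eq (hbJ j j.2)
      rcases hσ with rfl | rfl
      · exact Or.inl ⟨by linarith, by linarith⟩
      · exact Or.inr ⟨by linarith, by linarith⟩
  -- `X` is the set of inversions between the order along `b` and the order of the tails on side
  -- `β`.
  let X : J → J → Prop := fun j k => ∃ h : (j : Fin n) ≠ k, A.side b (A.meet h) = β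
  have hXsymm : ∀ j k, X j k → X k j := by
    rintro j k ⟨h, h'⟩
    exact ⟨h.symm, by rw [← h', A.side_meet_swap]⟩
  have hXnot : ∀ (j k : J) (h : (j : Fin n) ≠ k), ¬ X j k → A.side b (A.meet h) = -β := by
    intro j k h hX
    have h1 : A.side b (A.meet h) ≠ β := fun h' => hX ⟨h, h'⟩
    have h2 : A.side b (A.meet h) ≠ 0 := fun h' => by
      rcases A.eq_or_eq_of_side_eq_zero h (A.side_meet_left h) (A.side_meet_right h) h' with e | e
      · exact hbJ j j.2 e
      · exact hbJ k k.2 e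
    rcases A.side_cases b (A.meet h) with h3 | h3 | h3 <;> omega
  have hyb : ∀ j : J, A.side b (A.meet (hbJ j j.2)) = 0 := fun j => A.side_meet_left _
  have hyj : ∀ j : J, A.side j (A.meet (hbJ j j.2)) = 0 := fun j => A.side_meet_right _
  -- If `j` starts between `i` and `k` and crosses neither of them on side `β`, it keeps them apart
  -- there.
  have hC1 : ∀ i j k : J, d i < d j → d j < d k → X i k → ¬ X i j → ¬ X j k → False := by
    rintro i j k hij hjk ⟨hik, hX⟩ hXij hXjk
    have nij : (i : Fin n) ≠ j := fun h => by rw [Subtype.ext h] at hij; exact lt_irrefl _ hij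
    have njk : (j : Fin n) ≠ k := fun h => by rw [Subtype.ext h] at hjk; exact lt_irrefl _ hjk
    have h1 := A.side_eq_of_side_meet nij (hbJ i i.2).symm hnβ0 (hXnot i j nij hXij)
      (A.side_meet_left hik) (hyj i) (by omega) (by rw [hyb]; omega)
    have h2 := A.side_eq_of_side_meet njk.symm (hbJ k k.2).symm hnβ0
      (hXnot k j njk.symm fun h => hXjk (hXsymm _ _ h))
      (A.side_meet_right hik) (hyj k) (by omega) (by rw [hyb]; omega)
    rw [(hside j i).2 hij] at h1
    rw [(hside j k).1 hjk] at h2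
    have := hp0 j j.2
    omega
  -- If `i` and `k` do not cross on side `β`, then `j`, starting between them, leaves the strip they
  -- bound across one of them and can no longer reach the other.
  have hC2 : ∀ i j k : J, d i < d j → d j < d k → X i j → X j k → ¬ X i k → False := by
    rintro i j k hij hjk ⟨nij, hXij⟩ ⟨njk, hXjk⟩ hXik
    have nik : (i : Fin n) ≠ k := fun h => by
      rw [Subtype.ext h] at hij; exact lt_asymm hij hjk
    rw [A.side_meet_swap] at hXij
    have h1 := A.side_eq_of_side_meet nik (hbJ i i.2).symm hnβ0 (hXnot i k nik hXik)
      (A.side_meet_right nij.symm) (hyj i) (by omega) (by rw [hyb]; omega)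
    have h2 := A.side_eq_of_side_meet nik.symm (hbJ k k.2).symm hnβ0
      (hXnot k i nik.symm fun h => hXik (hXsymm _ _ h))
      (A.side_meet_right njk) (hyj k) (by omega) (by rw [hyb]; omega)
    rw [(hside k i).2 (hij.trans hjk)] at h1
    rw [(hside i k).1 (hij.trans hjk)] at h2
    have h3 := A.side_meet_eq_neg_or nij.symm njk (hbJ j j.2).symm nik hβ0 hXij hXjk
    rw [A.side_meet_swap (hbJ j j.2).symm, A.side_meet_swap (hbJ j j.2).symm,
      (hside i j).1 hij, (hside k j).2 hjk, h1, h2] at h3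
    have := hp0 i i.2
    have := hp0 k k.2
    omega
  -- `j` separates the tail of `k` from `p`, that is, the tail of `j` comes before that of `k` as
  -- seen from `p`; the tail sought is a minimal one.
  let rel : J → J → Prop := fun j k => A.side j (τ k) = -A.side j p
  have hrel : ∀ j k : J, (d j < d k → (rel j k ↔ ¬ X j k)) ∧ (d k < d j → (rel j k ↔ X j k)) := by
    intro j k
    have main : ∀ hjk : (j : Fin n) ≠ k,
        (X j k → A.side j (τ k) = -A.side j (A.meet (hbJ k k.2))) ∧
        (¬ X j k → A.side j (τ k) = A.side j (A.meet (hbJ k k.2))) := by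
      intro hjk
      constructor
      · intro hX
        obtain ⟨h, h'⟩ := hXsymm _ _ hX
        rw [(hτ k).side_eq_neg h (hbJ k k.2).symm hβ0 (hτb k) h', A.side_meet_swap]
      · intro hX
        exact A.side_eq_of_side_meet hjk.symm (hbJ k k.2).symm hnβ0
          (hXnot k j hjk.symm fun h => hX (hXsymm _ _ h)) (hτ k).side_self (hyj k)
          (by rw [hτb]; omega) (by rw [hyb]; omega)
    have hpj := hp0 j j.2
    constructor <;> intro h
    · have hjk : (j : Fin n) ≠ k := fun e => by rw [Subtype.ext e] at h; exact lt_irrefl _ h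
      have h1 := (hside j k).1 h
      have h2 := main hjk
      rw [h1] at h2
      by_cases hX : X j k
      · simp only [rel, hX, h2.1 hX, not_true, iff_false]; omega
      · simp only [rel, hX, h2.2 hX, not_false_iff]
    · have hjk : (j : Fin n) ≠ k := fun e => by rw [Subtype.ext e] at h; exact lt_irrefl _ h
      have h1 := (hside j k).2 h
      have h2 := main hjk
      rw [h1] at h2
      by_cases hX : X j k
      · simp only [rel, hX, h2.1 hX]
      · simp only [rel, hX, h2.2 hX, iff_false]; omega
  have hirr : ∀ j, ¬ rel j j := by
    intro j h
    simp only [rel, (hτ j).side_self] at h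
    have := hp0 j j.2
    omega
  have : Nonempty J := hJ.coe_sort
  obtain ⟨l, hl⟩ := exists_minimal_of_inversions hdinj hXsymm hC1 hC2 (fun j k => (hrel j k).1)
    (fun j k => (hrel j k).2) hirr
  refine ⟨l, l.2, τ l, hτ l, hτb l, fun j hj => ?_⟩
  have h1 : A.side j (τ l) ≠ -A.side j p := hl ⟨j, hj⟩
  have h2 := hp0 j hj
  rcases A.side_cases j (τ l) with h3 | h3 | h3 <;> rcases A.side_cases j p with h4 | h4 | h4 <;>
    omega

end SimpleArrangement

lemma Fin.exists_ne_ne {n : ℕ} (hn : 3 ≤ n) (a b : Fin n) : ∃ j, j ≠ a ∧ j ≠ b := by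
  by_contra! h
  have : (Finset.univ : Finset (Fin n)) ⊆ {a, b} := fun j _ => by
    by_cases hj : j = a
    · simp [hj]
    · simp [h j hj]
  have := (Finset.card_le_card this).trans Finset.card_le_two
  rw [Finset.card_univ, Fintype.card_fin] at this
  omega

/-! ### Diametrical vertices are those not separated from some tail point -/

namespace SimpleArrangement

variable {n : ℕ} (A : SimpleArrangement n)

/-- Two distinct vertices are joined by a walk which, after its start, stays on one side of one of
the two pseudolines through the start. -/
lemma exists_walk_side {p q : A.vertexSet} (hpq : p ≠ q) : ∃ a b, a ≠ b ∧ A.side a p = 0 ∧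
    A.side b p = 0 ∧ ∃ β : ℤ, (β = 1 ∨ β = -1) ∧ ∃ w : A.graph.Walk p q,
      ∀ v ∈ w.support, v = p ∨ A.side b v = β := by
  obtain ⟨w⟩ := A.reachable p q
  obtain ⟨a, b, hab, ha, hb, z, -, hzp, haz, w₂, -, hw₂⟩ := A.exists_leave hpq w
  have hbz := hw₂ z w₂.start_mem_support
  obtain ⟨r, hr⟩ := A.exists_segment ha haz
  refine ⟨a, b, hab, ha, hb, A.side b z, (A.side_cases b z).resolve_left hbz, r.append w₂, ?_⟩
  intro v hv
  rw [SimpleGraph.Walk.mem_support_append_iff] at hv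
  rcases hv with hv | hv
  · by_cases hbv : A.side b v = 0
    · exact Or.inl (Subtype.ext (A.eq_of_side_eq_zero hab (hr v hv).1 hbv ha hb))
    · exact Or.inr ((hr v hv).2.side_eq_right hb hbv)
  · exact Or.inr (A.side_eq_of_walk w₂ hw₂ v hv)

/-- A vertex at distance at least `n - 2` from another one can be seen from infinity. -/
lemma exists_compatible_tailPoint (hn : 3 ≤ n) {p q : A.vertexSet}
    (h : ∀ w : A.graph.Walk p q, n < w.length + 3) :
    ∃ l x, A.IsTailPoint l x ∧ A.Compatible p x := by
  have hpq : p ≠ q := by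
    rintro rfl
    have := h .nil
    rw [SimpleGraph.Walk.length_nil] at this
    omega
  obtain ⟨a, b, hab, ha, hb, β, hβ, w, hw⟩ := A.exists_walk_side hpq
  have hβ0 : β ≠ 0 := by omega
  obtain ⟨c, hc⟩ := A.exists_curve_eq hb
  have hca : c = A.crossParam b a := by
    rwa [← hc, A.side_curve_eq_zero_iff hab.symm] at ha
  have hcne : ∀ j, j ≠ a → b ≠ j → A.crossParam b j ≠ c := fun j hj hbj => by
    rw [hca]; exact A.crossParam_ne hbj hab.symm hj
  obtain ⟨j₀, hj₀a, hj₀b⟩ := Fin.exists_ne_ne hn a b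
  -- The direction along `b` from `p` is chosen so that some third pseudoline crosses `b` there.
  obtain ⟨σ, hσ, hσ₀⟩ : ∃ σ : ℝ, (σ = 1 ∨ σ = -1) ∧ 0 < σ * (A.crossParam b j₀ - c) := by
    rcases lt_or_gt_of_ne (hcne j₀ hj₀a hj₀b.symm) with h | h
    · exact ⟨-1, Or.inr rfl, by linarith⟩
    · exact ⟨1, Or.inl rfl, by linarith⟩
  classical
  -- The tail is taken on the side of `b` away from the walk, where the wrapping argument excludes
  -- crossings with pseudolines from beyond `p`.
  obtain ⟨l, hl, x, hx, hbx, hJ⟩ := A.exists_nearest_tail (c := c) hσ (β := -β) (by omega)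
    (Finset.univ.filter fun j => b ≠ j ∧ 0 < σ * (A.crossParam b j - c))
    ⟨j₀, by simpa using ⟨hj₀b.symm, hσ₀⟩⟩ (fun j hj => (Finset.mem_filter.1 hj).2.1)
    (fun j hj => (Finset.mem_filter.1 hj).2.2)
  refine ⟨l, x, hx, fun j => ?_⟩
  rw [hc] at hJ
  simp only [Finset.mem_filter, Finset.mem_univ, true_and, and_imp] at hl hJ
  obtain ⟨hbl, hl⟩ := hl
  by_cases hja : j = a
  · subst hja; exact Or.inl ha
  by_cases hjb : b = j
  · subst hjb; exact Or.inl hb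
  by_cases hj : 0 < σ * (A.crossParam b j - c)
  · rcases hJ j hjb hj with h' | h'
    · exact Or.inr (Or.inl h')
    · exact Or.inr (Or.inr h'.symm)
  have hla : l ≠ a := by
    rintro rfl
    rw [← hca] at hl
    simp at hl
  have hlj : l ≠ j := by rintro rfl; exact hj hl
  have h1 := hcne j hja hjb
  have hsides : A.side j (A.meet hbl) = A.side j p ∧ A.side l (A.meet hjb) = A.side l p := by
    rw [← hc, A.coe_meet, A.coe_meet]
    constructor
    · apply A.side_curve_eq hjb
      rcases hσ with rfl | rfl
      · exact Or.inr ⟨by linarith, lt_of_le_of_ne (by linarith) h1⟩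
      · exact Or.inl ⟨by linarith, lt_of_le_of_ne (by linarith) h1.symm⟩
    · apply A.side_curve_eq hbl
      rcases hσ with rfl | rfl
      · exact Or.inl ⟨by linarith, by linarith⟩
      · exact Or.inr ⟨by linarith, by linarith⟩
  have hne : ∀ k, k ≠ a → b ≠ k → A.side k p ≠ 0 := fun k hka hbk h0 => by
    rcases A.eq_or_eq_of_side_eq_zero hab ha hb h0 with e | e
    · exact hka e
    · exact hbk e.symm
  -- `l` and `j` cross `b` in different directions from `p`; were they to meet on side `-β`, they
  -- would wrap around `p` and allow a walk of length at most n - 3.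
  have hmeet : A.side b (A.meet hlj) = β := by
    have h2 : A.side b (A.meet hlj) ≠ -β := fun h2 => by
      obtain ⟨w', hw'⟩ := A.exists_short_walk_of_wrapping w hβ0 hb hw hbl hjb hlj
        (hne l hla hbl) (hne j hja hjb) hsides.2 hsides.1 h2
      have := h w'
      omega
    have h3 : A.side b (A.meet hlj) ≠ 0 := fun h0 => by
      rcases A.eq_or_eq_of_side_eq_zero hlj (A.side_meet_left _) (A.side_meet_right _) h0
        with e | e
      · exact hbl e
      · exact hjb e
    have := A.side_cases b (A.meet hlj)
    omega
  refine Or.inr (Or.inr ?_)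
  rw [← hsides.1]
  exact (A.side_eq_of_side_meet hlj hbl.symm hβ0 hmeet hx.side_self (A.side_meet_right hbl)
    (by rw [hbx]; omega) (by rw [A.side_meet_left]; exact hβ0.symm)).symm

lemma card_filter_side_eq_zero_le (v : A.vertexSet) [DecidablePred fun j => A.side j v = 0] :
    (Finset.univ.filter fun j => A.side j v = 0).card ≤ 2 := by
  classical
  obtain ⟨a, b, hab, ha, hb⟩ := A.exists_side_eq_zero v
  refine (Finset.card_le_card (t := {a, b}) fun j hj => ?_).trans Finset.card_le_two
  simp only [Finset.mem_filter, Finset.mem_univ, true_and] at hj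
  simpa using A.eq_or_eq_of_side_eq_zero hab ha hb hj

/-- Each pseudoline contributes 2, less 1 for each of the two vertices on it; as a vertex is on at
most two pseudolines, at most 4 is lost. -/
lemma le_sepDist_of_opposite {v q : A.vertexSet}
    (h : ∀ j, A.side j v ≠ 0 → A.side j q ≠ 0 → A.side j v = -A.side j q) :
    2 * (n : ℤ) - 4 ≤ A.sepDist v q := by
  classical
  have key : ∀ j, (2 : ℤ) - (if A.side j v = 0 then 1 else 0) - (if A.side j q = 0 then 1 else 0) ≤
      |A.side j v - A.side j q| := by
    intro j
    have hj := h j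
    rcases A.side_cases j v with h1 | h1 | h1 <;> rcases A.side_cases j q with h2 | h2 | h2 <;>
      simp_all
  have := Finset.sum_le_sum fun j (_ : j ∈ Finset.univ) => key j
  rw [Finset.sum_sub_distrib, Finset.sum_sub_distrib, Finset.sum_boole, Finset.sum_boole,
    Finset.sum_const, Finset.card_univ, Fintype.card_fin] at this
  have h1 := A.card_filter_side_eq_zero_le v
  have h2 := A.card_filter_side_eq_zero_le q
  rw [sepDist]
  simp only [nsmul_eq_mul] at this
  omega

/-- The vertices next to the two tails of a pseudoline. -/
lemma exists_extreme_vertices (hn : 3 ≤ n) (l : Fin n) {x : Plane} (hx : A.IsTailPoint l x) :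
    (∃ q : A.vertexSet, ∀ j, A.side j q ≠ 0 → A.side j x = -A.side j q) ∧
    ∃ q : A.vertexSet, ∀ j, A.side j q ≠ 0 → A.side j x = A.side j q := by
  obtain ⟨t, rfl, h⟩ := hx
  obtain ⟨j₀, hj₀, -⟩ := Fin.exists_ne_ne hn l l
  have hne : (Finset.univ.filter fun j => l ≠ j).Nonempty := ⟨j₀, by simpa using hj₀.symm⟩
  obtain ⟨c, hc, hmax⟩ := Finset.exists_max_image _ (A.crossParam l) hne
  obtain ⟨d, hd, hmin⟩ := Finset.exists_min_image _ (A.crossParam l) hne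
  simp only [Finset.mem_filter, Finset.mem_univ, true_and] at hc hd hmax hmin
  have hlt : ∀ e (hle : l ≠ e) j, A.side j (A.meet hle) ≠ 0 → ∃ hlj : l ≠ j,
      A.crossParam l j ≠ A.crossParam l e := by
    intro e hle j hj
    have hlj : l ≠ j := by rintro rfl; exact hj (A.side_meet_left hle)
    refine ⟨hlj, A.crossParam_ne hlj hle ?_⟩
    rintro rfl
    exact hj (A.side_meet_right hle)
  rcases h with h | h
  · refine ⟨⟨A.meet hc, fun j hj => ?_⟩, ⟨A.meet hd, fun j hj => ?_⟩⟩
    · obtain ⟨hlj, hne⟩ := hlt c hc j hj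
      rw [A.coe_meet]
      exact A.side_curve_eq_neg hlj (Or.inl ⟨h j hlj, lt_of_le_of_ne (hmax j hlj) hne⟩)
    · obtain ⟨hlj, hne⟩ := hlt d hd j hj
      rw [A.coe_meet]
      exact A.side_curve_eq hlj (Or.inl ⟨h j hlj, lt_of_le_of_ne (hmin j hlj) hne.symm⟩)
  · refine ⟨⟨A.meet hd, fun j hj => ?_⟩, ⟨A.meet hc, fun j hj => ?_⟩⟩
    · obtain ⟨hlj, hne⟩ := hlt d hd j hj
      rw [A.coe_meet]
      exact A.side_curve_eq_neg hlj (Or.inr ⟨h j hlj, lt_of_le_of_ne (hmin j hlj) hne.symm⟩)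
    · obtain ⟨hlj, hne⟩ := hlt c hc j hj
      rw [A.coe_meet]
      exact A.side_curve_eq hlj (Or.inr ⟨h j hlj, lt_of_le_of_ne (hmax j hlj) hne⟩)

/-- The vertex at the far end of `l` has signs opposite to those of `x` wherever its own are
nonzero, hence opposite to those of `v`. -/
lemma le_eccent_of_compatible (hn : 3 ≤ n) {v : A.vertexSet} {l : Fin n} {x : Plane}
    (hx : A.IsTailPoint l x) (hv : A.Compatible v x) : ((n - 2 : ℕ) : ℕ∞) ≤ A.graph.eccent v := by
  obtain ⟨q, hq⟩ := (A.exists_extreme_vertices hn l hx).1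
  have hd := A.le_sepDist_of_opposite (v := v) (q := q) fun j hjv hjq => by
    have h1 := hq j hjq
    rcases hv j with h | h | h
    · exact absurd h hjv
    · omega
    · omega
  refine le_trans ?_ (SimpleGraph.edist_le_eccent (v := q))
  obtain ⟨w, hw⟩ := (A.reachable v q).exists_walk_length_eq_edist
  rw [← hw]
  have := A.sepDist_le_length w
  exact_mod_cast (by omega : n - 2 ≤ w.length)

lemma edist_le (p q : A.vertexSet) : A.graph.edist p q ≤ ((n - 2 : ℕ) : ℕ∞) := by
  obtain ⟨w, hw⟩ := A.exists_walk_length_le p q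
  refine (SimpleGraph.edist_le w).trans ?_
  exact_mod_cast (by omega : w.length ≤ n - 2)

lemma ediam_eq (hn : 3 ≤ n) : A.graph.ediam = ((n - 2 : ℕ) : ℕ∞) := by
  refine le_antisymm (SimpleGraph.ediam_le_of_edist_le A.edist_le) ?_
  obtain ⟨j, hj, -⟩ := Fin.exists_ne_ne hn ⟨0, by omega⟩ ⟨0, by omega⟩
  obtain ⟨x, hx, -⟩ := A.exists_tailPoint hj (Or.inl rfl)
  obtain ⟨q, hq⟩ := (A.exists_extreme_vertices hn j hx).2
  refine (A.le_eccent_of_compatible hn (v := q) hx fun j => ?_).trans SimpleGraph.eccent_le_ediam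
  by_cases h : A.side j q = 0
  · exact Or.inl h
  · exact Or.inr (Or.inr (hq j h).symm)

lemma finite_vertexSet : A.vertexSet.Finite := by
  refine (Set.finite_range fun ij : Fin n × Fin n =>
    (A.line ij.1).curve (A.crossParam ij.1 ij.2)).subset ?_
  intro p hp
  obtain ⟨i, j, hij, hi, hj⟩ := A.exists_side_eq_zero ⟨p, hp⟩
  obtain ⟨t, rfl⟩ := A.exists_curve_eq hi
  exact ⟨(i, j), by rw [(A.side_curve_eq_zero_iff hij).1 hj]⟩

/-- A vertex is diametrical if and only if no pseudoline separates it from some point of an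
unbounded end segment. -/
lemma isDiametrical_iff_compatible (hn : 3 ≤ n) (v : A.vertexSet) :
    A.IsDiametrical v ↔ ∃ l x, A.IsTailPoint l x ∧ A.Compatible v x := by
  rw [IsDiametrical, A.ediam_eq hn]
  constructor
  · intro h
    have : Finite A.vertexSet := A.finite_vertexSet
    obtain ⟨q, hq⟩ := A.graph.exists_edist_eq_eccent_of_finite v
    refine A.exists_compatible_tailPoint hn (q := q) fun w => ?_
    have h1 := SimpleGraph.edist_le w
    rw [hq, h] at h1
    have : n - 2 ≤ w.length := by exact_mod_cast h1
    omega
  · rintro ⟨l, x, hx, hv⟩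
    refine le_antisymm ?_ (A.le_eccent_of_compatible hn hx hv)
    exact (A.graph.eccent_le_iff v _).2 fun q => A.edist_le v q

end SimpleArrangement

/-! ### Topology of cells and local structure at a pseudoline -/

section

open Set

/-- In polar coordinates this is the image of a half-line times the unit circle. -/
lemma Plane.isPreconnected_compl_closedBall {r : ℝ} (hr : 0 ≤ r) :
    IsPreconnected (Metric.closedBall (0 : Plane) r)ᶜ := by
  have hrank : 1 < Module.rank ℝ Plane := by
    rw [← Module.finrank_eq_rank, finrank_euclideanSpace_fin]
    exact_mod_cast one_lt_two
  have h : (Metric.closedBall (0 : Plane) r)ᶜ =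
      (fun z : ℝ × Plane => z.1 • z.2) '' (Ioi r ×ˢ Metric.sphere 0 1) := by
    ext y
    simp only [mem_compl_iff, mem_closedBall_zero_iff, not_le, mem_image, mem_prod, mem_Ioi,
      mem_sphere_zero_iff_norm, Prod.exists]
    constructor
    · intro hy
      have h0 : ‖y‖ ≠ 0 := (hr.trans_lt hy).ne'
      exact ⟨‖y‖, ‖y‖⁻¹ • y, ⟨hy, by rw [norm_smul, norm_inv, norm_norm, inv_mul_cancel₀ h0]⟩,
        by rw [smul_smul, mul_inv_cancel₀ h0, one_smul]⟩
    · rintro ⟨t, z, ⟨ht, hz⟩, rfl⟩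
      rw [norm_smul, hz, mul_one, Real.norm_of_nonneg (hr.trans ht.le)]
      exact ht
  rw [h]
  exact (isPreconnected_Ioi.prod (isPreconnected_sphere hrank 0 1)).image _
    continuous_smul.continuousOn

lemma Pseudoline.not_isBounded_image_curve (l : Pseudoline) {S : Set ℝ}
    (hS : ¬ Bornology.IsBounded S) : ¬ Bornology.IsBounded (l.curve '' S) := by
  intro h
  have hK : IsCompact (closure (l.curve '' S)) := h.isCompact_closure
  have hf : Continuous fun p : Plane => l.homeo.symm p 0 :=
    (EuclideanSpace.proj (𝕜 := ℝ) (0 : Fin 2)).continuous.comp l.homeo.symm.continuous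
  refine hS ((hK.image hf).isBounded.subset fun t ht => ?_)
  exact ⟨l.curve t, subset_closure ⟨t, ht, rfl⟩, by simp [Pseudoline.curve]⟩

namespace SimpleArrangement

variable {n : ℕ} (A : SimpleArrangement n)

lemma side_eq_iff {j : Fin n} {ε : ℤ} (hε : ε = 1 ∨ ε = -1) {p : Plane} :
    A.side j p = ε ↔ 0 < ε * (A.line j).height p := by
  rw [side]
  rcases lt_trichotomy ((A.line j).height p) 0 with h | h | h <;> rcases hε with rfl | rfl
  · simp [sign_neg h, h.le]
  · simp [sign_neg h, h]
  · simp [h]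
  · simp [h]
  · simp [sign_pos h, h]
  · simp [sign_pos h, h.le]

lemma isOpen_side_eq (j : Fin n) {ε : ℤ} (hε : ε = 1 ∨ ε = -1) :
    IsOpen {p | A.side j p = ε} := by
  simp only [A.side_eq_iff hε]
  exact isOpen_lt continuous_const (continuous_const.mul (A.line j).continuous_height)

/-- Near a point of a pseudoline, each side of the pseudoline is nonempty and connected. -/
lemma exists_nhd_side {l : Fin n} {z : Plane} (hz : A.side l z = 0) {ε : ℤ}
    (hε : ε = 1 ∨ ε = -1) {O : Set Plane} (hO : IsOpen O) (hzO : z ∈ O) :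
    ∃ N ⊆ O, IsOpen N ∧ z ∈ N ∧ (N ∩ {p | A.side l p = ε}).Nonempty ∧
      IsPreconnected (N ∩ {p | A.side l p = ε}) := by
  set h := (A.line l).homeo
  obtain ⟨r, hr, hball⟩ := Metric.isOpen_iff.1 (hO.preimage h.continuous) (h.symm z)
    (by simpa using hzO)
  have hεε : (ε : ℝ) * ε = 1 := by rcases hε with rfl | rfl <;> simp
  have hz1 : h.symm z 1 = 0 := by
    have := ((A.line l).mem_carrier_iff z).1 (A.side_eq_zero_iff.1 hz)
    exact this
  have hset : h '' Metric.ball (h.symm z) r ∩ {p | A.side l p = ε} =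
      h '' (Metric.ball (h.symm z) r ∩ {q | 0 < (ε : ℝ) * q 1}) := by
    rw [image_inter h.injective]
    ext p
    simp only [mem_inter_iff, and_congr_right_iff]
    rintro -
    rw [mem_ofPred_eq, A.side_eq_iff hε]
    constructor
    · intro hp
      exact ⟨h.symm p, hp, by simp⟩
    · rintro ⟨q, hq, rfl⟩
      rwa [Pseudoline.height_homeo]
  refine ⟨h '' Metric.ball (h.symm z) r, image_subset_iff.2 hball,
    h.isOpenMap _ Metric.isOpen_ball, ⟨h.symm z, Metric.mem_ball_self hr, by simp⟩, ?_, ?_⟩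
  · rw [hset]
    refine Nonempty.image _ ⟨h.symm z + PiLp.single 2 (1 : Fin 2) (ε * (r / 2)), ?_, ?_⟩
    · rw [Metric.mem_ball, dist_eq_norm, add_sub_cancel_left, PiLp.norm_single]
      rcases hε with rfl | rfl <;> simp [abs_of_pos hr, hr]
    · simp only [mem_ofPred_eq, PiLp.add_apply, hz1, PiLp.single_apply, if_true, zero_add]
      rw [← mul_assoc, hεε]
      linarith
  · rw [hset]
    refine (Convex.isPreconnected ?_).image _ h.continuous.continuousOn
    refine (convex_ball _ _).inter ?_
    have : IsLinearMap ℝ fun q : Plane => (ε : ℝ) * q 1 :=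
      ⟨fun x y => by simp [mul_add], fun c x => by simp; ring⟩
    exact convex_halfSpace_gt this 0

/-- The points on the prescribed sides of some of the pseudolines form a connected set. -/
lemma isPreconnected_cell {s : Fin n → ℤ} (hs : ∀ j, s j = 1 ∨ s j = -1) (J : Finset (Fin n)) :
    IsPreconnected {p | ∀ j ∈ J, A.side j p = s j} := by
  classical
  induction J using Finset.induction_on with
  | empty => simpa using isPreconnected_univ
  | insert l J hl ih =>
    set C := {p | ∀ j ∈ J, A.side j p = s j} with hC
    have hCopen : IsOpen C := by
      rw [hC, ofPred_forall]
      simp only [ofPred_forall]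
      exact isOpen_biInter_finset fun j _ => A.isOpen_side_eq j (hs j)
    have hD : {p | ∀ j ∈ insert l J, A.side j p = s j} = C ∩ {p | A.side l p = s l} := by
      ext p
      simp only [Finset.forall_mem_insert, mem_ofPred_eq, mem_inter_iff, hC, and_comm]
    rw [hD]
    set D := C ∩ {p | A.side l p = s l} with hDdef
    have hDopen : IsOpen D := hCopen.inter (A.isOpen_side_eq l (hs l))
    -- Signs are monotone along `l`, so `l` meets `C` in an interval of parameters.
    have hI : IsPreconnected (C ∩ {p | A.side l p = 0}) := by
      have hT : (C ∩ {p | A.side l p = 0}) =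
          (A.line l).curve '' {t | ∀ j ∈ J, A.side j ((A.line l).curve t) = s j} := by
        ext p
        constructor
        · rintro ⟨hp, hp0⟩
          obtain ⟨t, rfl⟩ := A.exists_curve_eq hp0
          exact ⟨t, hp, rfl⟩
        · rintro ⟨t, ht, rfl⟩
          exact ⟨ht, A.side_curve_self l t⟩
      rw [hT]
      refine (OrdConnected.isPreconnected ⟨?_⟩).image _ (A.line l).continuous_curve.continuousOn
      intro x hx y hy u hu j hj
      have := Between.side_eq (A.side_between (i := l) hu.1 hu.2) ((hx j hj).trans (hy j hj).symm)
      rw [this, hx j hj]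
    -- Suppose `D` splits into `U` and `V`. Near a point of `l` in `C` the chosen side is connected,
    -- so only one of `U`, `V` occurs there; by connectedness of `l` within `C` it is the same one
    -- throughout.
    intro U V hU hV hUV ⟨u, huD, huU⟩ ⟨v, hvD, hvV⟩
    by_contra hempty
    rw [not_nonempty_iff_eq_empty] at hempty
    have hdisj : ∀ p ∈ D, p ∈ U → p ∈ V → False := fun p h1 h2 h3 => by
      have : p ∈ D ∩ (U ∩ V) := ⟨h1, h2, h3⟩
      rw [hempty] at this
      exact this
    -- the open sets near whose points `D` is contained in `U`, respectively in `V`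
    set U' := interior (Dᶜ ∪ U) with hU'
    set V' := interior (Dᶜ ∪ V) with hV'
    have hUU' : U ⊆ U' := interior_maximal subset_union_right hU
    have hVV' : V ⊆ V' := interior_maximal subset_union_right hV
    have hother : ∀ p, A.side l p ≠ 0 → A.side l p ≠ s l → p ∈ U' ∧ p ∈ V' := by
      intro p h0 hsp
      have hp := (A.side_cases l p).resolve_left h0
      have hsub : {q | A.side l q = A.side l p} ⊆ Dᶜ := fun q hq hqD => hsp (hq ▸ hqD.2)
      exact ⟨interior_maximal (hsub.trans subset_union_left) (A.isOpen_side_eq l hp) rfl,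
        interior_maximal (hsub.trans subset_union_left) (A.isOpen_side_eq l hp) rfl⟩
    have hloc : ∀ p ∈ C ∩ {p | A.side l p = 0}, p ∈ U' ∨ p ∈ V' := by
      rintro p ⟨hpC, hp0⟩
      obtain ⟨N, hNC, hNopen, hpN, ⟨w, hwN, hw⟩, hpre⟩ := A.exists_nhd_side hp0 (hs l) hCopen hpC
      have hND : N ∩ {p | A.side l p = s l} ⊆ D := fun q hq => ⟨hNC hq.1, hq.2⟩
      have hcover := hND.trans hUV
      by_cases hmU : (N ∩ {p | A.side l p = s l} ∩ U).Nonempty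
      · left
        refine interior_maximal ?_ hNopen hpN
        intro q hq
        by_cases hqs : A.side l q = s l
        · right
          by_contra hqU
          have hqV : q ∈ V := (hcover ⟨hq, hqs⟩).resolve_left hqU
          obtain ⟨y, hy, hyU, hyV⟩ := hpre U V hU hV hcover hmU ⟨q, ⟨hq, hqs⟩, hqV⟩
          exact hdisj y (hND hy) hyU hyV
        · exact Or.inl fun hqD => hqs hqD.2
      · right
        refine interior_maximal ?_ hNopen hpN
        intro q hq
        by_cases hqs : A.side l q = s l
        · exact Or.inr ((hcover ⟨hq, hqs⟩).resolve_left fun h => hmU ⟨q, ⟨hq, hqs⟩, h⟩)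
        · exact Or.inl fun hqD => hqs hqD.2
    have hnot : ∀ p ∈ C ∩ {p | A.side l p = 0}, p ∈ U' → p ∈ V' → False := by
      rintro p ⟨hpC, hp0⟩ hpU hpV
      obtain ⟨N, hN, -, -, ⟨w, hwN, hw⟩, -⟩ := A.exists_nhd_side hp0 (hs l)
        ((hCopen.inter isOpen_interior).inter isOpen_interior) ⟨⟨hpC, hpU⟩, hpV⟩
      obtain ⟨⟨hwC, hwU⟩, hwV⟩ := hN hwN
      have hwD : w ∈ D := ⟨hwC, hw⟩
      exact hdisj w hwD ((interior_subset hwU).resolve_left fun h => h hwD)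
        ((interior_subset hwV).resolve_left fun h => h hwD)
    -- If it is `U`, then `U`, `l` and the other side of `l` together are separated from `V`, so `C`
    -- splits, against the induction hypothesis.
    have main : ∀ U V : Set Plane, IsOpen V → D ⊆ U ∪ V → U ⊆ interior (Dᶜ ∪ U) →
        (∀ p ∈ D, p ∈ U → p ∈ V → False) →
        (∀ p, A.side l p ≠ 0 → A.side l p ≠ s l → p ∈ interior (Dᶜ ∪ U)) →
        C ∩ {p | A.side l p = 0} ⊆ interior (Dᶜ ∪ U) →
        (D ∩ U).Nonempty → (D ∩ V).Nonempty → False := by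
      intro U V hV hUV hUU' hdisj hother hIU ⟨u, huD, huU⟩ ⟨v, hvD, hvV⟩
      have hcover : C ⊆ interior (Dᶜ ∪ U) ∪ (D ∩ V) := by
        intro p hp
        by_cases h0 : A.side l p = 0
        · exact Or.inl (hIU ⟨hp, h0⟩)
        by_cases hsp : A.side l p = s l
        · rcases hUV ⟨hp, hsp⟩ with h | h
          · exact Or.inl (hUU' h)
          · exact Or.inr ⟨⟨hp, hsp⟩, h⟩
        · exact Or.inl (hother p h0 hsp)
      obtain ⟨y, -, hyU, hyD, hyV⟩ := ih _ _ isOpen_interior (hDopen.inter hV) hcover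
        ⟨u, huD.1, hUU' huU⟩ ⟨v, hvD.1, hvD, hvV⟩
      exact hdisj y hyD ((interior_subset hyU).resolve_left fun h => h hyD) hyV
    by_cases hIU : (C ∩ {p | A.side l p = 0} ∩ V').Nonempty
    · refine main V U hU (hUV.trans (union_comm U V).subset) hVV' (fun p h1 h2 h3 => hdisj p h1 h3 h2)
        (fun p h1 h2 => (hother p h1 h2).2) ?_ ⟨v, hvD, hvV⟩ ⟨u, huD, huU⟩
      intro p hp
      by_contra hpV
      obtain ⟨y, hy, hyU, hyV⟩ := hI U' V' isOpen_interior isOpen_interior hloc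
        ⟨p, hp, (hloc p hp).resolve_right hpV⟩ hIU
      exact hnot y hy hyU hyV
    · refine main U V hV hUV hUU' hdisj (fun p h1 h2 => (hother p h1 h2).1) ?_
        ⟨u, huD, huU⟩ ⟨v, hvD, hvV⟩
      intro p hp
      exact (hloc p hp).resolve_right fun h => hIU ⟨p, hp, h⟩

lemma side_ne_zero_of_sign {s : Fin n → ℤ} (hs : ∀ j, s j = 1 ∨ s j = -1) (j : Fin n) :
    s j ≠ 0 := by
  have := hs j
  omega

lemma isOpen_setOf_side_eq {s : Fin n → ℤ} (hs : ∀ j, s j = 1 ∨ s j = -1) (J : Finset (Fin n)) :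
    IsOpen {p | ∀ j ∈ J, A.side j p = s j} := by
  simp only [ofPred_forall]
  exact isOpen_biInter_finset fun j _ => A.isOpen_side_eq j (hs j)

lemma mem_closure_cell_of_unique {s : Fin n → ℤ} (hs : ∀ j, s j = 1 ∨ s j = -1) {l : Fin n}
    {p : Plane} (hl : A.side l p = 0) (hp : ∀ j, j ≠ l → A.side j p = s j) :
    p ∈ closure {p | ∀ j ∈ Finset.univ, A.side j p = s j} := by
  rw [mem_closure_iff]
  intro O hO hpO
  obtain ⟨N, hN, -, -, ⟨w, hwN, hw⟩, -⟩ := A.exists_nhd_side hl (hs l)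
    (hO.inter (A.isOpen_setOf_side_eq hs (Finset.univ.erase l)))
    ⟨hpO, fun j hj => hp j (Finset.ne_of_mem_erase hj)⟩
  refine ⟨w, (hN hwN).1, fun j _ => ?_⟩
  by_cases hjl : j = l
  · subst hjl; exact hw
  · exact (hN hwN).2 j (Finset.mem_erase.2 ⟨hjl, Finset.mem_univ j⟩)

/-- Two perturbations: along `b` to the required side of `a`, then off `b`. Hence the passage to the
closure of a closure. -/
lemma vertex_mem_closure_cell {s : Fin n → ℤ} (hs : ∀ j, s j = 1 ∨ s j = -1) (v : A.vertexSet)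
    (hv : ∀ j, A.side j v = 0 ∨ A.side j v = s j) :
    (v : Plane) ∈ closure {p | ∀ j ∈ Finset.univ, A.side j p = s j} := by
  obtain ⟨a, b, hab, ha, hb⟩ := A.exists_side_eq_zero v
  obtain ⟨t, ht⟩ := A.exists_curve_eq hb
  have hta : t = A.crossParam b a := by
    rwa [← ht, A.side_curve_eq_zero_iff hab.symm] at ha
  have hne : ∀ j, j ≠ a → j ≠ b → A.side j v = s j := fun j hja hjb =>
    (hv j).resolve_left fun h => (A.eq_or_eq_of_side_eq_zero hab ha hb h).elim hja hjb
  rw [← closure_closure, mem_closure_iff]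
  intro O hO hvO
  have hopen := (hO.inter (A.isOpen_setOf_side_eq hs ((Finset.univ.erase a).erase b))).preimage
    (A.line b).continuous_curve
  obtain ⟨δ, hδ, hball⟩ := Metric.isOpen_iff.1 hopen t ⟨by rwa [ht], fun j hj => by
    simp only [Finset.mem_erase, Finset.mem_univ, and_true] at hj
    rw [ht]
    exact hne j hj.2 hj.1⟩
  obtain ⟨u, hu, hua⟩ : ∃ u ∈ Metric.ball t δ, A.side a ((A.line b).curve u) = s a := by
    have ho := A.orient_cases hab.symm
    have hsa := hs a
    by_cases h : A.orient b a = s a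
    · refine ⟨t + δ / 2, ?_, ?_⟩
      · rw [Metric.mem_ball, Real.dist_eq, add_sub_cancel_left, abs_of_pos (by linarith)]
        linarith
      · rw [A.side_curve_of_gt hab.symm (by linarith), h]
    · refine ⟨t - δ / 2, ?_, ?_⟩
      · rw [Metric.mem_ball, Real.dist_eq, sub_sub_cancel_left, abs_neg, abs_of_pos (by linarith)]
        linarith
      · rw [A.side_curve_of_lt hab.symm (by linarith)]
        omega
  obtain ⟨huO, huJ⟩ := hball hu
  refine ⟨_, huO, A.mem_closure_cell_of_unique hs (A.side_curve_self b u) fun j hjb => ?_⟩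
  by_cases hja : j = a
  · subst hja; exact hua
  · exact huJ j (by simp [hja, hjb])

/-! ### The outer face and the cells it contains -/

lemma exists_side_eq_zero_of_mem_realization {p : Plane} (hp : p ∈ A.realization) :
    ∃ i, A.side i p = 0 := by
  obtain ⟨i, -, u, -, -, -, -, -, rfl⟩ := hp
  exact ⟨i, A.side_curve_self i u⟩

variable {A} in
lemma IsTailPoint.notMem_realization {l : Fin n} {x : Plane} (hx : A.IsTailPoint l x) :
    x ∉ A.realization := by
  rintro ⟨i, s, u, t, hsu, hut, hs, ht, rfl⟩
  by_cases hli : l = i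
  · subst hli
    obtain ⟨t', he, h⟩ := hx
    obtain ⟨j, hlj, rfl⟩ := A.curve_mem_vertexSet_iff.1 hs
    obtain ⟨k, hlk, rfl⟩ := A.curve_mem_vertexSet_iff.1 ht
    have := (A.line l).curve_injective he
    rcases h with h | h
    · have := h j hlj
      linarith
    · have := h k hlk
      linarith
  · exact hx.side_ne_zero hli (A.side_curve_self i u)

lemma isTailPoint_of_notMem_realization {l : Fin n} {x : Plane} (hl : A.side l x = 0)
    (hx : x ∉ A.realization) : A.IsTailPoint l x := by
  obtain ⟨t, rfl⟩ := A.exists_curve_eq hl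
  refine ⟨t, rfl, ?_⟩
  by_contra! h
  obtain ⟨⟨j, hj, hjt⟩, k, hk, hkt⟩ := h
  exact hx ⟨l, _, t, _, hjt, hkt, A.curve_mem_vertexSet_iff.2 ⟨j, hj, rfl⟩,
    A.curve_mem_vertexSet_iff.2 ⟨k, hk, rfl⟩, rfl⟩

lemma isBounded_realization : Bornology.IsBounded A.realization := by
  choose M hM using fun i => (Set.finite_range (A.crossParam i)).bddAbove
  choose m hm using fun i => (Set.finite_range (A.crossParam i)).bddBelow
  have hb : Bornology.IsBounded (⋃ i, (A.line i).curve '' Icc (m i) (M i)) :=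
    Bornology.isBounded_iUnion.2 fun i =>
      (isCompact_Icc.image (A.line i).continuous_curve).isBounded
  refine hb.subset ?_
  rintro p ⟨i, s, u, t, hsu, hut, hs, ht, rfl⟩
  obtain ⟨j, -, rfl⟩ := A.curve_mem_vertexSet_iff.1 hs
  obtain ⟨k, -, rfl⟩ := A.curve_mem_vertexSet_iff.1 ht
  exact mem_iUnion.2 ⟨i, u, ⟨(hm i ⟨j, rfl⟩).trans hsu, hut.trans (hM i ⟨k, rfl⟩)⟩, rfl⟩

lemma vertexSet_subset_realization : A.vertexSet ⊆ A.realization := by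
  intro p hp
  obtain ⟨i, -, -, hi, -⟩ := A.exists_side_eq_zero ⟨p, hp⟩
  obtain ⟨t, ht⟩ := A.exists_curve_eq hi
  have hp' : (A.line i).curve t ∈ A.vertexSet := ht ▸ hp
  exact ⟨i, t, t, t, le_rfl, le_rfl, hp', hp', ht.symm⟩

variable {A} in
/-- The unbounded end segment through a tail point, as a subset of a face. -/
lemma IsTailPoint.exists_ray {l : Fin n} {x : Plane} (hx : A.IsTailPoint l x) :
    ∃ S ⊆ A.realizationᶜ, x ∈ S ∧ IsPreconnected S ∧ ¬ Bornology.IsBounded S := by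
  obtain ⟨t, rfl, h | h⟩ := hx
  · refine ⟨(A.line l).curve '' Iic t, ?_, ⟨t, self_mem_Iic, rfl⟩,
      isPreconnected_Iic.image _ (A.line l).continuous_curve.continuousOn,
      (A.line l).not_isBounded_image_curve fun hb => not_bddBelow_Iic t hb.bddBelow⟩
    rintro _ ⟨u, hu, rfl⟩
    exact IsTailPoint.notMem_realization ⟨u, rfl, Or.inl fun j hj => lt_of_le_of_lt hu (h j hj)⟩
  · refine ⟨(A.line l).curve '' Ici t, ?_, ⟨t, self_mem_Ici, rfl⟩,
      isPreconnected_Ici.image _ (A.line l).continuous_curve.continuousOn,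
      (A.line l).not_isBounded_image_curve fun hb => not_bddAbove_Ici t hb.bddAbove⟩
    rintro _ ⟨u, hu, rfl⟩
    exact IsTailPoint.notMem_realization ⟨u, rfl, Or.inr fun j hj => lt_of_lt_of_le (h j hj) hu⟩

/-- A common cell has `v` and `x` in its closure. It misses all pseudolines and stays connected when
`x` is added, so it lies in the face of `x`, which is unbounded because it contains the rest of the
tail. -/
lemma liesInOuterFace_of_compatible {v : A.vertexSet} {l : Fin n} {x : Plane}
    (hx : A.IsTailPoint l x) (hv : A.Compatible v x) : A.LiesInOuterFace v := by
  obtain ⟨S, hS, hxS, hSpre, hSb⟩ := hx.exists_ray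
  refine ⟨connectedComponentIn A.realizationᶜ x, ⟨⟨x, hS hxS, rfl⟩, fun hb => hSb (hb.subset
    (hSpre.subset_connectedComponentIn hxS hS))⟩, ?_⟩
  obtain ⟨s, hs, hvs, hxs⟩ : ∃ s : Fin n → ℤ, (∀ j, s j = 1 ∨ s j = -1) ∧
      (∀ j, A.side j v = 0 ∨ A.side j v = s j) ∧ ∀ j, A.side j x = 0 ∨ A.side j x = s j := by
    have : ∀ j, ∃ e : ℤ, (e = 1 ∨ e = -1) ∧ (A.side j v = 0 ∨ A.side j v = e) ∧
        (A.side j x = 0 ∨ A.side j x = e) := by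
      intro j
      rcases hv j with h | h | h
      · rcases A.side_cases j x with h' | h'
        · exact ⟨1, Or.inl rfl, Or.inl h, Or.inl h'⟩
        · exact ⟨_, h', Or.inl h, Or.inr rfl⟩
      · rcases A.side_cases j v with h' | h'
        · exact ⟨1, Or.inl rfl, Or.inl h', Or.inl h⟩
        · exact ⟨_, h', Or.inr rfl, Or.inl h⟩
      · rcases A.side_cases j x with h' | h'
        · exact ⟨1, Or.inl rfl, Or.inl (h.trans h'), Or.inl h'⟩
        · exact ⟨_, h', Or.inr h, Or.inr rfl⟩
    choose s h1 h2 using this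
    exact ⟨s, h1, fun j => (h2 j).1, fun j => (h2 j).2⟩
  set W := {p | ∀ j ∈ Finset.univ, A.side j p = s j} with hW
  have hxW : x ∈ closure W := A.mem_closure_cell_of_unique hs hx.side_self fun j hj =>
    (hxs j).resolve_left (hx.side_ne_zero hj.symm)
  have hWR : W ⊆ A.realizationᶜ := fun p hp hpR => by
    obtain ⟨i, hi⟩ := A.exists_side_eq_zero_of_mem_realization hpR
    exact side_ne_zero_of_sign hs i ((hp i (Finset.mem_univ i)).symm.trans hi)
  have hpre : IsPreconnected (insert x W) := (A.isPreconnected_cell hs Finset.univ).subset_closure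
    (subset_insert x W) (insert_subset hxW subset_closure)
  have hWF : W ⊆ connectedComponentIn A.realizationᶜ x := (subset_insert x W).trans
    (hpre.subset_connectedComponentIn (mem_insert x W) (insert_subset (hS hxS) hWR))
  exact ⟨closure_mono hWF (A.vertex_mem_closure_cell hs v hvs), fun hint =>
    connectedComponentIn_subset _ _ (interior_subset hint) (A.vertexSet_subset_realization v.2)⟩

/-- A cell of the arrangement without a tail on its boundary is bounded, hence so is every
face of the realization inside it. -/
lemma isBounded_cell {s : Fin n → ℤ} (hs : ∀ j, s j = 1 ∨ s j = -1) (l : Fin n)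
    (hfr : closure {p | ∀ j, A.side j p = s j} ∩ A.realizationᶜ ⊆ {p | ∀ j, A.side j p = s j}) :
    Bornology.IsBounded {p | ∀ j, A.side j p = s j} := by
  set W := {p | ∀ j, A.side j p = s j} with hW
  have hWopen : IsOpen W := by
    simpa using A.isOpen_setOf_side_eq hs Finset.univ
  obtain ⟨r, hr0, hr⟩ := A.isBounded_realization.subset_closedBall_lt 0 0
  by_contra hb
  have hex : ∀ T : Set Plane, ¬ Bornology.IsBounded T →
      (T ∩ (Metric.closedBall (0 : Plane) r)ᶜ).Nonempty := by
    intro T hT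
    by_contra h
    rw [not_nonempty_iff_eq_empty, ← disjoint_iff_inter_eq_empty, disjoint_compl_right_iff_subset]
      at h
    exact hT (Metric.isBounded_closedBall.subset h)
  obtain ⟨w, hwW, hw⟩ := hex W hb
  obtain ⟨_, ⟨t, -, rfl⟩, hy⟩ := hex _ ((A.line l).not_isBounded_image_curve
    (S := univ) fun h => not_bddAbove_univ h.bddAbove)
  -- `W` is clopen outside a large disc, where the plane is connected; an unbounded `W` would fill
  -- that region, yet it misses the points of `l` there.
  have hcover : (Metric.closedBall (0 : Plane) r)ᶜ ⊆ W ∪ (closure W)ᶜ := by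
    intro p hp
    by_cases hpc : p ∈ closure W
    · exact Or.inl (hfr ⟨hpc, fun h => hp (hr h)⟩)
    · exact Or.inr hpc
  have hyW : (A.line l).curve t ∉ W := fun h =>
    side_ne_zero_of_sign hs l ((h l).symm.trans (A.side_curve_self l t))
  obtain ⟨z, -, hzW, hz⟩ := Plane.isPreconnected_compl_closedBall hr0.le W _ hWopen
    isClosed_closure.isOpen_compl hcover ⟨w, hw, hwW⟩ ⟨_, hy, (hcover hy).resolve_left hyW⟩
  exact hz (subset_closure hzW)

lemma exists_compatible_of_liesInOuterFace (v : A.vertexSet) (h : A.LiesInOuterFace v) :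
    ∃ l x, A.IsTailPoint l x ∧ A.Compatible v x := by
  obtain ⟨F, ⟨⟨y, hy, rfl⟩, hFb⟩, hvF⟩ := h
  by_contra! hno
  set F := connectedComponentIn A.realizationᶜ y with hF
  have hFR : F ⊆ A.realizationᶜ := connectedComponentIn_subset _ _
  have hnbhd : IsOpen {p | ∀ j, A.side j v ≠ 0 → A.side j p = A.side j v} := by
    simp only [ofPred_forall]
    exact isOpen_iInter_of_finite fun j => isOpen_iInter_of_finite fun hj =>
      A.isOpen_side_eq j ((A.side_cases j v).resolve_left hj)
  obtain ⟨x, hxv, hxF⟩ := mem_closure_iff.1 (frontier_subset_closure hvF) _ hnbhd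
    (fun j _ => rfl)
  -- A point of a pseudoline outside the realization is a tail point, and this one is too near `v`
  -- to be separated from it.
  have hx0 : ∀ j, A.side j x ≠ 0 := by
    intro j hj
    refine hno j x (A.isTailPoint_of_notMem_realization hj (hFR hxF)) fun k => ?_
    by_cases hk : A.side k v = 0
    · exact Or.inl hk
    · exact Or.inr (Or.inr (hxv k hk).symm)
  have hs : ∀ j, A.side j x = 1 ∨ A.side j x = -1 := fun j =>
    (A.side_cases j x).resolve_left (hx0 j)
  set W := {p | ∀ j, A.side j p = A.side j x} with hW
  have hWopen : IsOpen W := by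
    simpa using A.isOpen_setOf_side_eq hs Finset.univ
  have hcl : ∀ p ∈ closure W, ∀ j, A.side j p = 0 ∨ A.side j p = A.side j x := by
    intro p hp j
    by_contra! hj
    obtain ⟨w, hw, hwW⟩ := mem_closure_iff.1 hp _
      (A.isOpen_side_eq j ((A.side_cases j p).resolve_left hj.1)) rfl
    exact hj.2 (hw.symm.trans (hwW j))
  -- For the same reason `W` has no boundary points outside the realization, so the connected set
  -- `F`, which meets `W`, lies in `W`.
  have hfr : closure W ∩ A.realizationᶜ ⊆ W := by
    rintro p ⟨hpW, hpR⟩ j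
    refine (hcl p hpW j).resolve_left fun h0 => ?_
    refine hno j p (A.isTailPoint_of_notMem_realization h0 hpR) fun k => ?_
    by_cases hk : A.side k v = 0
    · exact Or.inl hk
    · rcases hcl p hpW k with h | h
      · exact Or.inr (Or.inl h)
      · exact Or.inr (Or.inr (by rw [h, hxv k hk]))
  have hFW : F ⊆ W := by
    by_contra hsub
    obtain ⟨p, hpF, hpW⟩ := not_subset.1 hsub
    have hcover : F ⊆ W ∪ (closure W)ᶜ := fun q hq => by
      by_cases hqc : q ∈ closure W
      · exact Or.inl (hfr ⟨hqc, hFR hq⟩)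
      · exact Or.inr hqc
    obtain ⟨z, -, hzW, hz⟩ := isPreconnected_connectedComponentIn W _ hWopen
      isClosed_closure.isOpen_compl hcover ⟨x, hxF, fun j => rfl⟩
      ⟨p, hpF, (hcover hpF).resolve_left hpW⟩
    exact hz (subset_closure hzW)
  obtain ⟨l, -⟩ := A.exists_side_eq_zero v
  exact hFb ((A.isBounded_cell hs l hfr).subset hFW)

end SimpleArrangement

end

theorem theorem2 {n : ℕ} (hn : 3 ≤ n) (A : SimpleArrangement n) :
    A.graph.ediam = ((n - 2 : ℕ) : ℕ∞) ∧
      ∀ v : A.vertexSet, A.IsDiametrical v ↔ A.LiesInOuterFace v := by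
  refine ⟨A.ediam_eq hn, fun v => (A.isDiametrical_iff_compatible hn v).trans ⟨?_, ?_⟩⟩
  · rintro ⟨l, x, hx, hv⟩
    exact A.liesInOuterFace_of_compatible hx hv
  · exact A.exists_compatible_of_liesInOuterFace v
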